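/- **Setting.** Let $\pi\colon E\to M$ be a smooth fibre bundle (more generally, a smooth submersion), $\dim M=m\ge 1$, $\dim E=m+N$, with $M$ oriented by a smooth nowhere-vanishing $m$-form $\omega$. Let $\pi^1\colon J^1E\to E$ and $\bar\pi^1=\pi\circ\pi^1\colon J^1E\to M$ be the projections of the first jet bundle; a point $\bar y\in J^1E$ over $y\in E$, $x=\pi(y)$, is identified with the tangent map $\sigma_{\bar y}\colon T_xM\to T_yE$ of any local section representing it. Let $\mathcal L=\pounds\,\bar\pi^{1*}\omega$ with $\pounds\in C^\infty(J^1E)$, let $\Theta_{\mathcal L}=i(\mathcal V)\mathcal L+\mathcal L$ ($\mathcal V$ the vertical endomorphism) and $\Omega_{\mathcal L}=-d\Theta_{\mathcal L}$ be the Poincaré–Cartan forms; in adapted coordinates with $\omega=dx^1\wedge\dots\wedge dx^m$, $$\Theta_{\mathcal L}=\frac{\partial\pounds}{\partial v^A_\alpha}\,dy^A\wedge d^{m-1}x_\alpha-\Big(\frac{\partial\pounds}{\partial v^A_\alpha}v^A_\alpha-\pounds\Big)d^mx .$$ Let $\mathcal M\pi=\Lambda^m_1T^*E$ be the bundle of $m$-forms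 on $E$ vanishing by the action of two $\pi$-vertical vectors, with projections $\kappa\colon\mathcal M\pi\to E$, $\bar\kappa=\pi\circ\kappa\colon\mathcal M\pi\to M$, Liouville form $\Theta_\eta(w_1,\dots,w_m)=\eta(T\kappa\,w_1,\dots,T\kappa\,w_m)$ and $\Omega=-d\Theta$. The extended Legendre map $F:=\widetilde{\mathcal{FL}}\colon J^1E\to\mathcal M\pi$ is defined by $F(\bar y)(T\pi^1w_1,\dots,T\pi^1w_m)=\Theta_{\mathcal L}(w_1,\dots,w_m)$ for $w_i\in T_{\bar y}J^1E$. Let $S$ be a $\bar\pi^1$-transverse submanifold of $J^1E$ (possibly only immersed; $S=J^1E$ is allowed). All objects below are smooth and need only be given at the points of $S$; objects given on all of $J^1E$ are restricted to $S$, and "on $S$" means at all points $\bar y$ of $S$. At $\bar y$, objects on $J^1E$ take values over $\bar y$, and objects along $F$ take values over $F(\bar y)$. * *Jet fields.* A jet field $\Psi$ on $J^1E$ has values in $J^1(J^1E\to M)$, a jet field $Y$ along $F$ has values in $J^1(\mathcal M\pi\to M)$; $j^1F$ denotes the prolongation of $F$. $\Psi$ is an *Euler–Lagrange jet field* on $S$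 if $j^1\pi^1\circ\Psi=\mathrm{Id}$ (semi-holonomy) and $i(\Psi)\Omega_{\mathcal L}=0$. $Y$ is an *extended jet field operator* on $S$ if $j^1\kappa\circ Y=\mathrm{Id}$ and $F^*[i(Y)(\Omega\circ F)]=0$. Here $i(\Psi)\beta(Z_1,\dots,Z_m,w)=\beta(\Psi Z_1,\dots,\Psi Z_m,w)$ for $Z_i\in T_xM$, and $F^*$ pulls back the remaining tangent argument by $TF$. * *Multivector fields.* A class $\{X\}$ of $m$-vector fields consists of all $fX$, with $X$ non-vanishing and locally decomposable and $f$ a non-vanishing smooth function. $\{X\}$ is a class of *Euler–Lagrange $m$-vector fields* on $S$ if every member $X$ is $\bar\pi^1$-transverse ($i(X)\bar\pi^{1*}\omega\neq0$ everywhere), semi-holonomic (the line spanned by $\Lambda^mT\pi^1X_{\bar y}$ is $\Lambda^m(\operatorname{Im}\sigma_{\bar y})$), and satisfies $i(X)\Omega_{\mathcal L}=0$. A class $\{K\}$ of $m$-vector fields along $F$ is a class of *extended $m$-vector field operators* on $S$ if every member $K$ is $\bar\kappa$-transverse, semi-holonomic (the line spanned by $\Lambda^mT\kappa\,K_{\bar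 y}$ is $\Lambda^m(\operatorname{Im}\sigma_{\bar y})$), and satisfies $F^*[i(K)(\Omega\circ F)]=0$. * *Connections.* An Ehresmann connection form $\nabla$ on $J^1E\to M$ (resp. $\nabla'$ along $F$ for $\mathcal M\pi\to M$) is a $TJ^1E$-valued (resp. $T\mathcal M\pi$-valued) semibasic $1$-form whose contraction with every semibasic $1$-form $\xi$ is $\xi$; it is regarded as a linear map from $T_xM$ at each point. $\nabla$ is an *Euler–Lagrange connection* on $S$ if $T\pi^1\circ\nabla_{\bar y}=\sigma_{\bar y}$ and $i(\nabla)\Omega_{\mathcal L}=(m-1)\Omega_{\mathcal L}$. $\nabla'$ is an *extended connection operator* on $S$ if $T\kappa\circ\nabla'_{\bar y}=\sigma_{\bar y}$ and $F^*[i(\nabla')(\Omega\circ F)-(m-1)(\Omega\circ F)]=0$. **Theorem.** 1. Let $Y$ be an extended jet field operator on $S$ and $\Psi$ a jet field on $J^1E$ (on $S$) with $j^1F\circ\Psi=Y$ on $S$. Then $\Psi$ is an Euler–Lagrange jet field on $S$. Conversely, if $\Psi$ is an Euler–Lagrange jet field on $S$, there is exactly one extended jet field operator $Y$ on $S$ with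 $j^1F\circ\Psi=Y$ on $S$. 2. Let $\{K\}$ be a class of extended $m$-vector field operators on $S$ and $\{X\}$ a class of non-vanishing, locally decomposable $m$-vector fields on $J^1E$ (on $S$) such that for every $K\in\{K\}$ there is $X\in\{X\}$ with $\Lambda^mTF\circ X=K$ on $S$. Then $\{X\}$ is a class of Euler–Lagrange $m$-vector fields on $S$. Conversely, if $\{X\}$ is a class of Euler–Lagrange $m$-vector fields on $S$, there is exactly one class $\{K\}$ of extended $m$-vector field operators on $S$ such that for every $K\in\{K\}$ there is $X\in\{X\}$ with $\Lambda^mTF\circ X=K$ on $S$. 3. Let $\nabla'$ be an extended connection operator on $S$ and $\nabla$ an Ehresmann connection form on $J^1E\to M$ (on $S$) with $(\mathrm{id}\otimes TF)\circ\nabla=\nabla'$ on $S$. Then $\nabla$ is an Euler–Lagrange connection on $S$. Conversely, if $\nabla$ is an Euler–Lagrange connection on $S$, there is exactly one extended connection operator $\nabla'$ on $S$ with $(\mathrm{id}\otimes TF)\circ\nabla=\nabla'$ on $S$. -/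

import Mathlib

open Set Manifold ContDiff

set_option linter.unusedSectionVars false

noncomputable section

namespace FieldOp

/-! ## Fibred manifolds and natural bundles over them

`τ : B → M` is a fibred manifold over `M`, the total space being modelled on `X × G` and the base
on `X`. From a family of fibres that has coordinates in every adapted chart, depending smoothly on
the chart, one obtains a new manifold, again fibred over `M`. First jets and momenta are built in
this way. -/

section Fibered
variable (X G : Type*) [NormedAddCommGroup X] [NormedSpace ℝ X] [NormedAddCommGroup G] [NormedSpace ℝ G]
variable {B M : Type*} [TopologicalSpace B] [ChartedSpace (X × G) B] [TopologicalSpace M] [ChartedSpace X M]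

/-- `τ : B → M` is a fibred manifold (a smooth submersion): around every point of `B` there are
charts of `B` and `M` in which `τ` is the projection `X × G → X`. Every smooth fibre bundle is of
this kind. -/
class Fibered (τ : B → M) : Prop where
  submersion : IsSubmersionOfComplement G 𝓘(ℝ, X × G) 𝓘(ℝ, X) ∞ τ

/-- A pair of smooth charts `e` of `B` and `c` of `M` adapted to `τ`: `τ` is the first projection in
these charts. -/
structure AdaptedChart (τ : B → M) where
  e : OpenPartialHomeomorph B (X × G)
  c : OpenPartialHomeomorph M X
  he : e ∈ IsManifold.maximalAtlas 𝓘(ℝ, X × G) ∞ B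
  hc : c ∈ IsManifold.maximalAtlas 𝓘(ℝ, X) ∞ M
  maps : ∀ b ∈ e.source, τ b ∈ c.source
  fst_eq : ∀ b ∈ e.source, (e b).1 = c (τ b)

theorem trans_mem_maximalAtlas {V W : Type*} [NormedAddCommGroup V] [NormedSpace ℝ V]
    [TopologicalSpace W] [ChartedSpace V W] {e : OpenPartialHomeomorph W V}
    (he : e ∈ IsManifold.maximalAtlas 𝓘(ℝ, V) ∞ W) (L : V ≃L[ℝ] V) :
    e.trans L.toHomeomorph.toOpenPartialHomeomorph ∈ IsManifold.maximalAtlas 𝓘(ℝ, V) ∞ W := by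
  have hL : L.toHomeomorph.toOpenPartialHomeomorph ∈ contDiffGroupoid ∞ 𝓘(ℝ, V) := by
    rw [contDiffGroupoid, mem_groupoid_of_pregroupoid]
    constructor
    · simpa [contDiffPregroupoid] using L.contDiff.contDiffOn
    · simpa [contDiffPregroupoid] using L.symm.contDiff.contDiffOn
  intro e' he'
  obtain ⟨h1, h2⟩ := he e' he'
  constructor
  · rw [OpenPartialHomeomorph.trans_symm_eq_symm_trans_symm, OpenPartialHomeomorph.trans_assoc]
    exact StructureGroupoid.trans _ (StructureGroupoid.symm _ hL) h1
  · rw [← OpenPartialHomeomorph.trans_assoc]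
    exact StructureGroupoid.trans _ h2 hL

theorem Fibered.exists_chart {τ : B → M} [h : Fibered X G τ] (b : B) :
    ∃ a : AdaptedChart X G τ, b ∈ a.e.source := by
  obtain ⟨d⟩ := h.submersion b
  obtain ⟨eq, heq⟩ := d.property
  refine ⟨⟨d.domChart.trans eq.toHomeomorph.toOpenPartialHomeomorph, d.codChart,
    trans_mem_maximalAtlas d.domChart_mem_maximalAtlas eq, d.codChart_mem_maximalAtlas, ?_, ?_⟩, ?_⟩
  · intro b hb
    simp at hb
    exact d.source_subset_preimage_source hb
  · intro b hb
    simp at hb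
    have := heq (x := d.domChart b) (by simp [hb])
    simp [hb] at this
    simp [this]
  · simp [d.mem_domChart_source]

/-- The total space of a family of fibres `Fib b`. -/
structure FibTotal (Fib : B → Type*) where
  pt : B
  val : Fib pt

variable {X G} in
/-- The domain, in the model of `a`, of the transition from `a` to `a'`. -/
def AdaptedChart.overlap {τ : B → M} (a a' : AdaptedChart X G τ) : Set (X × G) :=
  a.e.target ∩ a.e.symm ⁻¹' a'.e.source

/-- Coordinates, with values in `Q`, on the fibres `Fib b` in every adapted chart, such that the
changes of coordinates are smooth functions of base point and fibre coordinate. -/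
structure FibModel (τ : B → M) (Fib : B → Type*) (Q : Type*) [NormedAddCommGroup Q]
    [NormedSpace ℝ Q] where
  coord : ∀ (a : AdaptedChart X G τ) (b : B), b ∈ a.e.source → Fib b ≃ Q
  smooth : ∀ a a' : AdaptedChart X G τ, ∃ T : (X × G) × Q → Q,
    ContDiffOn ℝ ∞ T (a.overlap a' ×ˢ univ) ∧
    ∀ b (h : b ∈ a.e.source) (h' : b ∈ a'.e.source) (f : Fib b),
      coord a' b h' f = T (a.e b, coord a b h f)

variable {X G}
variable {τ : B → M} [Fibered X G τ] {Fib : B → Type*} {Q : Type*} [NormedAddCommGroup Q]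
    [NormedSpace ℝ Q] (F : FibModel X G τ Fib Q)

namespace FibModel

theorem nonempty {τ : B → M} [Fibered X G τ] {Fib : B → Type*} {Q : Type*}
    [NormedAddCommGroup Q] [NormedSpace ℝ Q] (F : FibModel X G τ Fib Q) (b : B) : Nonempty (FibTotal Fib) := by
  obtain ⟨a, ha⟩ := Fibered.exists_chart X G (τ := τ) b
  exact ⟨⟨b, (F.coord a b ha).symm 0⟩⟩

open Classical in
/-- The chart `(x, y, q)` of the total space induced by an adapted chart `(x, y)` of `B`. -/
def chart (a : AdaptedChart X G τ) : PartialEquiv (FibTotal Fib) (X × (G × Q)) where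
  toFun p := ((a.e p.pt).1, (a.e p.pt).2,
    if h : p.pt ∈ a.e.source then F.coord a p.pt h p.val else 0)
  invFun u := if h : (u.1, u.2.1) ∈ a.e.target then
    ⟨a.e.symm (u.1, u.2.1), (F.coord a _ (a.e.map_target h)).symm u.2.2⟩
    else (F.nonempty (a.e.symm (u.1, u.2.1))).some
  source := {p | p.pt ∈ a.e.source}
  target := {u | (u.1, u.2.1) ∈ a.e.target}
  map_source' p hp := by simpa using a.e.map_source hp
  map_target' u hu := by simp [show (u.1, u.2.1) ∈ a.e.target from hu, a.e.map_target hu]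
  left_inv' := by
    rintro ⟨b, f⟩ hp
    have hp : b ∈ a.e.source := hp
    have ht := a.e.map_source hp
    simp only [Prod.mk.eta, ht, hp, dite_true]
    have key : ∀ b' (hb : b' = b) (h' : b' ∈ a.e.source), (⟨b', (F.coord a b' h').symm
      (F.coord a b hp f)⟩ : FibTotal Fib) = ⟨b, f⟩ := by
      rintro b' rfl h'
      simp
    exact key _ (a.e.left_inv hp) _
  right_inv' := by
    intro u hu
    have hu : (u.1, u.2.1) ∈ a.e.target := hu
    rw [dif_pos hu]
    simp [a.e.map_target hu, a.e.right_inv hu]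

theorem chart_symm_apply {a : AdaptedChart X G τ} {u : X × (G × Q)}
    (hu : (u.1, u.2.1) ∈ a.e.target) : (F.chart a).symm u =
      ⟨a.e.symm (u.1, u.2.1), (F.coord a _ (a.e.map_target hu)).symm u.2.2⟩ :=
  dif_pos hu

theorem chart_apply {a : AdaptedChart X G τ} {b : B} {f : Fib b}
    (hb : b ∈ a.e.source) : F.chart a ⟨b, f⟩ = ((a.e b).1, (a.e b).2, F.coord a b hb f) :=
  congrArg (fun q : Q => ((a.e b).1, (a.e b).2, q)) (dif_pos hb)

theorem chart_trans (a a' : AdaptedChart X G τ) :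
    IsOpen ((F.chart a).symm.trans (F.chart a')).source ∧
    ContDiffOn ℝ ∞ ((F.chart a).symm.trans (F.chart a'))
      ((F.chart a).symm.trans (F.chart a')).source := by
  have hs : ((F.chart a).symm.trans (F.chart a')).source
      = (fun u : X × (G × Q) => (u.1, u.2.1)) ⁻¹' (a.overlap a') := by
    ext u
    simp only [chart, PartialEquiv.trans_source, PartialEquiv.symm_source, mem_inter_iff,
      mem_ofPred_eq, mem_preimage, AdaptedChart.overlap]
    refine and_congr_right fun h => ?_
    simp [h]
  rw [hs]
  have ho : IsOpen (a.overlap a') := a.e.isOpen_inter_preimage_symm a'.e.open_source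
  refine ⟨ho.preimage (by fun_prop), ?_⟩
  obtain ⟨T, hT, hTeq⟩ := F.smooth a a'
  have h1 : ContDiffOn ℝ ∞ (a'.e ∘ a.e.symm) (a.overlap a') := by
    have := (contDiffGroupoid ∞ 𝓘(ℝ, X × G)).compatible_of_mem_maximalAtlas a.he a'.he
    rw [contDiffGroupoid, mem_groupoid_of_pregroupoid] at this
    simpa [contDiffPregroupoid, AdaptedChart.overlap] using this.1
  have hp : ContDiffOn ℝ ∞ (fun u : X × (G × Q) => (u.1, u.2.1))
    ((fun u : X × (G × Q) => (u.1, u.2.1)) ⁻¹' (a.overlap a')) := by fun_prop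
  have h2 := h1.comp hp (fun _ h => h)
  have h3 := hT.comp (g := T) (f := fun u : X × (G × Q) => ((u.1, u.2.1), u.2.2))
    (s := (fun u : X × (G × Q) => (u.1, u.2.1)) ⁻¹' (a.overlap a')) (by fun_prop)
    (fun u h => ⟨h, mem_univ _⟩)
  refine (h2.fst.prodMk (h2.snd.prodMk h3)).congr fun u hu => ?_
  have hu1 : (u.1, u.2.1) ∈ a.e.target := hu.1
  have hu2 : a.e.symm (u.1, u.2.1) ∈ a'.e.source := hu.2
  have := hTeq _ (a.e.map_target hu1) hu2 ((F.coord a _ (a.e.map_target hu1)).symm u.2.2)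
  rw [PartialEquiv.coe_trans, Function.comp, F.chart_symm_apply hu1, F.chart_apply hu2, this]
  simp [a.e.right_inv hu1]

/-- The manifold structure of the total space, with the induced charts as atlas. -/
def core : ChartedSpaceCore (X × (G × Q)) (FibTotal Fib) where
  atlas := range F.chart
  chartAt p := F.chart (Fibered.exists_chart X G (τ := τ) p.pt).choose
  mem_chart_source p := (Fibered.exists_chart X G (τ := τ) p.pt).choose_spec
  chart_mem_atlas p := mem_range_self _
  open_source := by
    rintro _ _ ⟨a, rfl⟩ ⟨a', rfl⟩
    exact (F.chart_trans a a').1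
  continuousOn_toFun := by
    rintro _ _ ⟨a, rfl⟩ ⟨a', rfl⟩
    exact (F.chart_trans a a').2.continuousOn

theorem isManifold_core :
    letI := F.core.toTopologicalSpace
    letI := F.core.toChartedSpace
    IsManifold 𝓘(ℝ, X × (G × Q)) ∞ (FibTotal Fib) := by
  let := F.core.toTopologicalSpace
  let := F.core.toChartedSpace
  refine isManifold_of_contDiffOn _ _ _ ?_
  rintro _ _ he he'
  obtain ⟨_, ⟨a, rfl⟩, rfl⟩ := mem_iUnion₂.1 he
  obtain ⟨_, ⟨a', rfl⟩, rfl⟩ := mem_iUnion₂.1 he'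
  exact (F.chart_trans a a').2.mono fun u hu => hu.1

theorem fibered_core :
    letI := F.core.toTopologicalSpace
    letI := F.core.toChartedSpace
    Fibered X (G × Q) (fun p : FibTotal Fib => τ p.pt) := by
  let := F.core.toTopologicalSpace
  let := F.core.toChartedSpace
  have := F.isManifold_core
  refine ⟨fun p => ?_⟩
  obtain ⟨a, ha⟩ := Fibered.exists_chart X G (τ := τ) p.pt
  refine ⟨⟨F.core.openPartialHomeomorph (F.chart a) (mem_range_self a), a.c, ha, a.maps _ ha, ?_,
    a.hc, fun q hq => a.maps _ hq, ContinuousLinearEquiv.refl ℝ _, ?_⟩⟩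
  · apply IsManifold.subset_maximalAtlas
    exact mem_iUnion₂.2 ⟨_, mem_range_self a, rfl⟩
  · intro u hu
    have hu : u ∈ (F.core.openPartialHomeomorph (F.chart a) (mem_range_self a)).target := by
      simpa using hu
    have hu : (u.1, u.2.1) ∈ a.e.target := hu
    have := a.fst_eq _ (a.e.map_target hu)
    rw [a.e.right_inv hu] at this
    change a.c (τ ((F.chart a).symm u).pt) = u.1
    rw [F.chart_symm_apply hu]
    exact this.symm

end FibModel

namespace AdaptedChart
variable {τ : B → M} (a : AdaptedChart X G τ) {b : B}

/-- The tangent map of the chart `e` at `b`. -/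
def dE (b : B) : TangentSpace 𝓘(ℝ, X × G) b →L[ℝ] X × G :=
  mfderiv 𝓘(ℝ, X × G) 𝓘(ℝ, X × G) a.e b

/-- The tangent map of the inverse of the chart `e` at `e b`. -/
def dESymm (b : B) : X × G →L[ℝ] TangentSpace 𝓘(ℝ, X × G) b :=
  mfderiv 𝓘(ℝ, X × G) 𝓘(ℝ, X × G) a.e.symm (a.e b)

/-- The tangent map of the chart `c` at `τ b`. -/
def dC (b : B) : TangentSpace 𝓘(ℝ, X) (τ b) →L[ℝ] X :=
  mfderiv 𝓘(ℝ, X) 𝓘(ℝ, X) a.c (τ b)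

/-- The tangent map of the inverse of the chart `c` at `c (τ b)`. -/
def dCSymm (b : B) : X →L[ℝ] TangentSpace 𝓘(ℝ, X) (τ b) :=
  mfderiv 𝓘(ℝ, X) 𝓘(ℝ, X) a.c.symm (a.c (τ b))

end AdaptedChart

theorem mdiff_chart {V W : Type*} [NormedAddCommGroup V] [NormedSpace ℝ V]
    [TopologicalSpace W] [ChartedSpace V W] [IsManifold 𝓘(ℝ, V) ∞ W] {e : OpenPartialHomeomorph W V}
    (he : e ∈ IsManifold.maximalAtlas 𝓘(ℝ, V) ∞ W) : e.MDifferentiable 𝓘(ℝ, V) 𝓘(ℝ, V) :=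
  ⟨(contMDiffOn_of_mem_maximalAtlas he).mdifferentiableOn (by simp),
    (contMDiffOn_symm_of_mem_maximalAtlas he).mdifferentiableOn (by simp)⟩

section
variable {V W : Type*} [NormedAddCommGroup V] [NormedSpace ℝ V]
    [TopologicalSpace W] [ChartedSpace V W] [IsManifold 𝓘(ℝ, V) ∞ W] {e e' : OpenPartialHomeomorph W V}

theorem fderiv_transition (he : e ∈ IsManifold.maximalAtlas 𝓘(ℝ, V) ∞ W)
    (he' : e' ∈ IsManifold.maximalAtlas 𝓘(ℝ, V) ∞ W) {w : W} (hw : w ∈ e.source)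
    (hw' : w ∈ e'.source) (v : V) :
    fderiv ℝ (e' ∘ e.symm) (e w) v = mfderiv 𝓘(ℝ, V) 𝓘(ℝ, V) e' w
      (mfderiv 𝓘(ℝ, V) 𝓘(ℝ, V) e.symm (e w) v : V) := by
  have h1 := (mdiff_chart he').mdifferentiableAt hw'
  have h2 := (mdiff_chart he).mdifferentiableAt_symm (e.map_source hw)
  have key : ∀ w' : W, w' = w → ∀ x : V, (mfderiv 𝓘(ℝ, V) 𝓘(ℝ, V) e' w' x : V) =
      (mfderiv 𝓘(ℝ, V) 𝓘(ℝ, V) e' w x : V) := by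
    rintro _ rfl _
    rfl
  have h3 := h1
  rw [← e.left_inv hw] at h3
  have h4 := mfderiv_comp_apply (e w) h3 h2 v
  have h5 : fderiv ℝ (e' ∘ e.symm) (e w) v =
    (mfderiv 𝓘(ℝ, V) 𝓘(ℝ, V) (e' ∘ e.symm) (e w) v : V) :=
    congrArg (fun L : V →L[ℝ] V => L v) mfderiv_eq_fderiv.symm
  exact h5.trans (h4.trans (key _ (e.left_inv hw) _))

theorem contDiffOn_transition (he : e ∈ IsManifold.maximalAtlas 𝓘(ℝ, V) ∞ W)
    (he' : e' ∈ IsManifold.maximalAtlas 𝓘(ℝ, V) ∞ W) :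
    ContDiffOn ℝ ∞ (e' ∘ e.symm) (e.target ∩ e.symm ⁻¹' e'.source) := by
  have := (contDiffGroupoid ∞ 𝓘(ℝ, V)).compatible_of_mem_maximalAtlas he he'
  rw [contDiffGroupoid, mem_groupoid_of_pregroupoid] at this
  simpa [contDiffPregroupoid] using this.1

theorem contDiffOn_fderiv_transition (he : e ∈ IsManifold.maximalAtlas 𝓘(ℝ, V) ∞ W)
    (he' : e' ∈ IsManifold.maximalAtlas 𝓘(ℝ, V) ∞ W) :
    ContDiffOn ℝ ∞ (fderiv ℝ (e' ∘ e.symm)) (e.target ∩ e.symm ⁻¹' e'.source) :=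
  (contDiffOn_transition he he').fderiv_of_isOpen
    (e.isOpen_inter_preimage_symm e'.open_source) (by simp)

theorem mfderiv_symm_chart (he : e ∈ IsManifold.maximalAtlas 𝓘(ℝ, V) ∞ W)
    {w : W} (hw : w ∈ e.source) (v : TangentSpace 𝓘(ℝ, V) w) :
    mfderiv 𝓘(ℝ, V) 𝓘(ℝ, V) e.symm (e w) (mfderiv 𝓘(ℝ, V) 𝓘(ℝ, V) e w v) = v :=
  congrArg (fun L => L v) ((mdiff_chart he).symm_comp_deriv hw)

theorem mfderiv_chart_symm (he : e ∈ IsManifold.maximalAtlas 𝓘(ℝ, V) ∞ W)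
    {w : W} (hw : w ∈ e.source) (v : V) :
    mfderiv 𝓘(ℝ, V) 𝓘(ℝ, V) e w (mfderiv 𝓘(ℝ, V) 𝓘(ℝ, V) e.symm (e w) v : V) = v := by
  have key : ∀ w' : W, w' = w → ∀ x : V, (mfderiv 𝓘(ℝ, V) 𝓘(ℝ, V) e w' x : V) =
      (mfderiv 𝓘(ℝ, V) 𝓘(ℝ, V) e w x : V) := by
    rintro _ rfl _
    rfl
  have := congrArg (fun L : V →L[ℝ] V => L v) ((mdiff_chart he).comp_symm_deriv (e.map_source hw))
  exact (key _ (e.left_inv hw) _).symm.trans this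
end

namespace AdaptedChart
variable {τ : B → M} (a a' : AdaptedChart X G τ) {b : B}
variable [IsManifold 𝓘(ℝ, X × G) ∞ B] [IsManifold 𝓘(ℝ, X) ∞ M]

@[simp] theorem dESymm_dE (hb : b ∈ a.e.source) (v) : a.dESymm b (a.dE b v) = v :=
  mfderiv_symm_chart a.he hb v

@[simp] theorem dE_dESymm (hb : b ∈ a.e.source) (v) : a.dE b (a.dESymm b v) = v :=
  mfderiv_chart_symm a.he hb v

@[simp] theorem dCSymm_dC (hb : b ∈ a.e.source) (v) : a.dCSymm b (a.dC b v) = v :=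
  mfderiv_symm_chart a.hc (a.maps b hb) v

@[simp] theorem dC_dCSymm (hb : b ∈ a.e.source) (v) : a.dC b (a.dCSymm b v) = v :=
  mfderiv_chart_symm a.hc (a.maps b hb) v

theorem dE_dESymm' (hb : b ∈ a.e.source) (hb' : b ∈ a'.e.source) (v) :
    a'.dE b (a.dESymm b v) = fderiv ℝ (a'.e ∘ a.e.symm) (a.e b) v :=
  (fderiv_transition a.he a'.he hb hb' v).symm

theorem dC_dCSymm' (hb : b ∈ a.e.source) (hb' : b ∈ a'.e.source) (v) :
    a'.dC b (a.dCSymm b v) = fderiv ℝ (a'.c ∘ a.c.symm) (a.c (τ b)) v :=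
  (fderiv_transition a.hc a'.hc (a.maps b hb) (a'.maps b hb') v).symm

theorem contMDiffAt (hb : b ∈ a.e.source) : ContMDiffAt 𝓘(ℝ, X × G) 𝓘(ℝ, X) ∞ τ b := by
  have h1 : ContMDiffAt 𝓘(ℝ, X × G) 𝓘(ℝ, X) ∞ (fun b => a.c.symm (a.e b).1) b := by
    have h2 := contMDiffAt_of_mem_maximalAtlas a.he hb
    have h3 : ContMDiffAt 𝓘(ℝ, X × G) 𝓘(ℝ, X) ∞ (Prod.fst : X × G → X) (a.e b) :=
      contDiff_fst.contDiffAt.contMDiffAt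
    have h4 := contMDiffAt_symm_of_mem_maximalAtlas a.hc (x := (a.e b).1)
      (by rw [a.fst_eq b hb]; exact a.c.map_source (a.maps b hb))
    exact h4.comp b (h3.comp b h2)
  refine h1.congr_of_eventuallyEq ?_
  filter_upwards [a.e.open_source.mem_nhds hb] with b' hb'
  rw [a.fst_eq b' hb', a.c.left_inv (a.maps b' hb')]

theorem fst_dE (hb : b ∈ a.e.source) (v) :
    (a.dE b v).1 = a.dC b (mfderiv 𝓘(ℝ, X × G) 𝓘(ℝ, X) τ b v) := by
  have h1 : MDifferentiableAt 𝓘(ℝ, X × G) 𝓘(ℝ, X) τ b :=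
    (a.contMDiffAt hb).mdifferentiableAt (by simp)
  have h2 := (mdiff_chart a.hc).mdifferentiableAt (a.maps b hb)
  have h4 := (mdiff_chart a.he).mdifferentiableAt hb
  have h5 : HasMFDerivAt 𝓘(ℝ, X × G) 𝓘(ℝ, X) (Prod.fst : X × G → X) (a.e b)
      (ContinuousLinearMap.fst ℝ X G) := hasFDerivAt_fst.hasMFDerivAt
  have h6 := h5.comp b h4.hasMFDerivAt
  have h3 := h2.hasMFDerivAt.comp b h1.hasMFDerivAt
  have h7 : (Prod.fst ∘ a.e : B → X) =ᶠ[nhds b] a.c ∘ τ := by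
    filter_upwards [a.e.open_source.mem_nhds hb] with b' hb'
    exact a.fst_eq b' hb'
  have h8 := hasMFDerivAt_unique h6 (h3.congr_of_eventuallyEq h7)
  exact congrArg (fun L : X × G →L[ℝ] X => L v) h8

theorem mfderiv_dESymm (hb : b ∈ a.e.source) (v) :
    mfderiv 𝓘(ℝ, X × G) 𝓘(ℝ, X) τ b (a.dESymm b v) = a.dCSymm b v.1 := by
  have := a.fst_dE hb (a.dESymm b v)
  rw [a.dE_dESymm hb] at this
  rw [this, a.dCSymm_dC hb]

end AdaptedChart

variable (X G) in
/-- The 1-jets at `b` of local sections of `τ`. The 1-jet `j¹φ(x)` of a section `φ` with `φ x = b` is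
identified with the tangent map `T_xφ : T_xM → T_bB`; these maps are exactly the linear sections
of `T_bτ`. -/
def JetAt (τ : B → M) (b : B) : Type _ :=
  {σ : TangentSpace 𝓘(ℝ, X) (τ b) →L[ℝ] TangentSpace 𝓘(ℝ, X × G) b //
    ∀ v, mfderiv 𝓘(ℝ, X × G) 𝓘(ℝ, X) τ b (σ v) = v}

variable (X G) in
/-- The jet coordinates `v^A_α` in an adapted chart: the derivative of the fibre components of a
section. -/
def jetModel (τ : B → M) [IsManifold 𝓘(ℝ, X × G) ∞ B] [IsManifold 𝓘(ℝ, X) ∞ M] :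
    FibModel X G τ (JetAt X G τ) (X →L[ℝ] G) where
  coord a b hb :=
    { toFun := fun σ => (ContinuousLinearMap.snd ℝ X G).comp ((a.dE b).comp (σ.1.comp (a.dCSymm b)))
      invFun := fun v => ⟨(a.dESymm b).comp (((ContinuousLinearMap.id ℝ X).prod v).comp (a.dC b)),
        fun w => by simp [a.mfderiv_dESymm hb, a.dCSymm_dC hb]⟩
      left_inv := fun σ => by
        apply Subtype.ext
        ext w
        have h1 := a.fst_dE hb (σ.1 w)
        rw [σ.2 w] at h1
        have h2 : (a.dC b w, (a.dE b (σ.1 w)).2) = a.dE b (σ.1 w) := Prod.ext h1.symm rfl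
        simp [a.dCSymm_dC hb, h2, a.dESymm_dE hb]
      right_inv := fun v => by
        ext w
        simp [a.dC_dCSymm hb, a.dE_dESymm hb] }
  smooth a a' := by
    refine ⟨fun p => (ContinuousLinearMap.snd ℝ X G).comp
      ((fderiv ℝ (a'.e ∘ a.e.symm) p.1).comp (((ContinuousLinearMap.id ℝ X).prod p.2).comp
        (fderiv ℝ (a.c ∘ a'.c.symm) (a'.e (a.e.symm p.1)).1))), ?_, ?_⟩
    · have ho : ContDiffOn ℝ ∞ (fun p : (X × G) × (X →L[ℝ] G) => fderiv ℝ (a'.e ∘ a.e.symm) p.1)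
          (a.overlap a' ×ˢ univ) :=
        (contDiffOn_fderiv_transition a.he a'.he).comp contDiff_fst.contDiffOn fun p hp => hp.1
      have ht : ContDiffOn ℝ ∞ (fun p : (X × G) × (X →L[ℝ] G) => (a'.e (a.e.symm p.1)).1)
          (a.overlap a' ×ˢ univ) :=
        contDiff_fst.comp_contDiffOn ((contDiffOn_transition a.he a'.he).comp
          contDiff_fst.contDiffOn fun p hp => hp.1)
      have hc : ContDiffOn ℝ ∞ (fun p : (X × G) × (X →L[ℝ] G) =>
          fderiv ℝ (a.c ∘ a'.c.symm) (a'.e (a.e.symm p.1)).1) (a.overlap a' ×ˢ univ) := by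
        refine (contDiffOn_fderiv_transition a'.hc a.hc).comp ht fun p hp => ?_
        have h1 := hp.1.1
        have h2 : a.e.symm p.1 ∈ a'.e.source := hp.1.2
        have h3 := a.maps _ (a.e.map_target h1)
        have h4 := a'.maps _ h2
        simp [a'.fst_eq _ h2, h3, h4]
      have hv : ContDiffOn ℝ ∞ (fun p : (X × G) × (X →L[ℝ] G) =>
          (ContinuousLinearMap.id ℝ X).prod p.2) (a.overlap a' ×ˢ univ) := by
        have : ContDiff ℝ ∞ (fun v : X →L[ℝ] G => (ContinuousLinearMap.id ℝ X).prod v) := by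
          have h : (fun v : X →L[ℝ] G => (ContinuousLinearMap.id ℝ X).prod v) = fun v =>
              (ContinuousLinearMap.inl ℝ X G) + (ContinuousLinearMap.inr ℝ X G).comp v := by
            ext v w <;> simp
          rw [h]
          exact contDiff_const.add (contDiff_const.clm_comp contDiff_id)
        exact this.comp_contDiffOn contDiff_snd.contDiffOn
      exact contDiffOn_const.clm_comp (ho.clm_comp (hv.clm_comp hc))
    · intro b h h' σ
      ext w
      have h1 := a'.dC_dCSymm' a h' h w
      have h2 := a.fst_dE h (σ.1 (a'.dCSymm b w))
      rw [σ.2] at h2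
      have h3 : (a.dC b (a'.dCSymm b w), (a.dE b (σ.1 (a'.dCSymm b w))).2) =
        a.dE b (σ.1 (a'.dCSymm b w)) := Prod.ext h2.symm rfl
      have h4 := a.dE_dESymm' a' h h' (a.dE b (σ.1 (a'.dCSymm b w)))
      rw [a.dESymm_dE h] at h4
      change (a'.dE b (σ.1 (a'.dCSymm b w))).2 = (fderiv ℝ (a'.e ∘ a.e.symm) (a.e b)
        (fderiv ℝ (a.c ∘ a'.c.symm) (a'.e (a.e.symm (a.e b))).1 w, (a.dE b (σ.1 (a.dCSymm b
          (fderiv ℝ (a.c ∘ a'.c.symm) (a'.e (a.e.symm (a.e b))).1 w)))).2)).2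
      rw [a.e.left_inv h, a'.fst_eq b h', ← h1, a.dCSymm_dC h, h3, ← h4]

variable (X G) in
/-- The `m`-forms on `T_bB` that vanish when two of their arguments are `τ`-vertical. -/
def MomAt (m : ℕ) (τ : B → M) (b : B) : Type _ :=
  {η : TangentSpace 𝓘(ℝ, X × G) b [⋀^Fin m]→L[ℝ] ℝ // ∀ v i j, i ≠ j →
    mfderiv 𝓘(ℝ, X × G) 𝓘(ℝ, X) τ b (v i) = 0 → mfderiv 𝓘(ℝ, X × G) 𝓘(ℝ, X) τ b (v j) = 0 →
      η v = 0}

variable (X G) in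
/-- The `m`-forms on `X × G` that vanish when two of their arguments are vertical. -/
def momSpace (m : ℕ) : Submodule ℝ ((X × G) [⋀^Fin m]→L[ℝ] ℝ) where
  carrier := {η | ∀ v i j, i ≠ j → (v i).1 = 0 → (v j).1 = 0 → η v = 0}
  zero_mem' := fun _ _ _ _ _ _ => rfl
  add_mem' := fun h h' v i j hij hi hj => by simp [h v i j hij hi hj, h' v i j hij hi hj]
  smul_mem' := fun c _ h v i j hij hi hj => by simp [h v i j hij hi hj]

variable (X G) in
/-- The inclusion of `momSpace` into the space of continuous multilinear maps. -/
def momSpace.toMulti (m : ℕ) : momSpace X G m →L[ℝ] ContinuousMultilinearMap ℝ (fun _ : Fin m => X × G) ℝ :=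
  (ContinuousAlternatingMap.toContinuousMultilinearMapLI (𝕜 := ℝ) (E := X × G) (F := ℝ)
    (ι := Fin m)).toContinuousLinearMap.comp (momSpace X G m).subtypeL

theorem exists_continuous_leftInverse {V W : Type*} [NormedAddCommGroup V] [NormedSpace ℝ V]
    [NormedAddCommGroup W] [NormedSpace ℝ W] [FiniteDimensional ℝ W] (T : V →L[ℝ] W)
    (hT : Function.Injective T) : ∃ P : W →L[ℝ] V, ∀ q, P (T q) = q := by
  obtain ⟨P, hP⟩ := T.toLinearMap.exists_leftInverse_of_injective (LinearMap.ker_eq_bot.2 hT)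
  exact ⟨P.toContinuousLinearMap, fun q => congrArg (fun L : V →ₗ[ℝ] V => L q) hP⟩

theorem momSpace.exists_leftInverse (X G : Type*) [NormedAddCommGroup X] [NormedSpace ℝ X]
    [NormedAddCommGroup G] [NormedSpace ℝ G] [FiniteDimensional ℝ X] [FiniteDimensional ℝ G]
    (m : ℕ) : ∃ P : ContinuousMultilinearMap ℝ (fun _ : Fin m => X × G) ℝ →L[ℝ] momSpace X G m,
      ∀ q, P (momSpace.toMulti X G m q) = q := by
  have : FiniteDimensional ℝ (ContinuousMultilinearMap ℝ (fun _ : Fin m => X × G) ℝ) :=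
    Module.Finite.of_injective (ContinuousMultilinearMap.toMultilinearMapLinear :
      ContinuousMultilinearMap ℝ (fun _ : Fin m => X × G) ℝ →ₗ[ℝ]
        MultilinearMap ℝ (fun _ : Fin m => X × G) ℝ)
      ContinuousMultilinearMap.toMultilinearMap_injective
  refine exists_continuous_leftInverse (V := momSpace X G m) (momSpace.toMulti X G m) ?_
  intro q q' h
  exact Subtype.val_injective (ContinuousAlternatingMap.toContinuousMultilinearMap_injective h)

variable (X G) in
/-- Coordinates on the momenta in an adapted chart: the local expression of the form. -/
def momModel (m : ℕ) (τ : B → M) [IsManifold 𝓘(ℝ, X × G) ∞ B] [IsManifold 𝓘(ℝ, X) ∞ M]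
    [FiniteDimensional ℝ X] [FiniteDimensional ℝ G] :
    FibModel X G τ (MomAt X G m τ) (momSpace X G m) where
  coord a b hb :=
    { toFun := fun η => ⟨η.1.compContinuousLinearMap (a.dESymm b), fun v i j hij hi hj =>
        η.2 _ i j hij (by simp [a.mfderiv_dESymm hb, hi]) (by simp [a.mfderiv_dESymm hb, hj])⟩
      invFun := fun q => ⟨q.1.compContinuousLinearMap (a.dE b), fun v i j hij hi hj =>
        q.2 _ i j hij (by simp [a.fst_dE hb, hi]) (by simp [a.fst_dE hb, hj])⟩
      left_inv := fun η => by
        apply Subtype.ext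
        ext v
        simp [Function.comp_def, a.dESymm_dE hb]
      right_inv := fun q => by
        apply Subtype.ext
        ext v
        simp [Function.comp_def, a.dE_dESymm hb] }
  smooth a a' := by
    obtain ⟨P, hP⟩ := momSpace.exists_leftInverse X G m
    refine ⟨fun p => P (ContinuousMultilinearMap.compContinuousLinearMapContinuousMultilinear ℝ
      (fun _ : Fin m => X × G) (fun _ => X × G) ℝ
        (fun _ => fderiv ℝ (a.e ∘ a'.e.symm) (a'.e (a.e.symm p.1))) (momSpace.toMulti X G m p.2)),
      ?_, ?_⟩
    · have ht : ContDiffOn ℝ ∞ (fun p : (X × G) × momSpace X G m => a'.e (a.e.symm p.1))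
          (a.overlap a' ×ˢ univ) :=
        (contDiffOn_transition a.he a'.he).comp contDiff_fst.contDiffOn fun p hp => hp.1
      have ho : ContDiffOn ℝ ∞ (fun p : (X × G) × momSpace X G m =>
          fderiv ℝ (a.e ∘ a'.e.symm) (a'.e (a.e.symm p.1))) (a.overlap a' ×ˢ univ) := by
        refine (contDiffOn_fderiv_transition a'.he a.he).comp ht fun p hp => ?_
        have h1 := hp.1.1
        have h2 : a.e.symm p.1 ∈ a'.e.source := hp.1.2
        simp [h2, a.e.map_target h1]
      have hT : ContDiffOn ℝ ∞ (fun p : (X × G) × momSpace X G m =>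
          (ContinuousMultilinearMap.compContinuousLinearMapContinuousMultilinear ℝ
            (fun _ : Fin m => X × G) (fun _ => X × G) ℝ
            (fun _ => fderiv ℝ (a.e ∘ a'.e.symm) (a'.e (a.e.symm p.1))))
              (momSpace.toMulti X G m p.2)) (a.overlap a' ×ˢ univ) := by
        refine ContDiffOn.clm_apply ?_ ?_
        · exact (ContinuousMultilinearMap.contDiff _).comp_contDiffOn (contDiffOn_pi.2 fun _ => ho)
        · exact (ContinuousLinearMap.contDiff (𝕜 := ℝ) (E := momSpace X G m)
            (F := ContinuousMultilinearMap ℝ (fun _ : Fin m => X × G) ℝ)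
            (momSpace.toMulti X G m)).comp_contDiffOn
              (contDiff_snd (E := X × G) (F := momSpace X G m)).contDiffOn
      exact (ContinuousLinearMap.contDiff (𝕜 := ℝ)
        (E := ContinuousMultilinearMap ℝ (fun _ : Fin m => X × G) ℝ)
        (F := momSpace X G m) P).comp_contDiffOn hT
    · intro b h h' η
      refine (hP _).symm.trans (congrArg P ?_)
      ext v
      change η.1 _ = η.1 _
      congr 1
      funext i
      change a'.dESymm b (v i) = a.dESymm b (fderiv ℝ (a.e ∘ a'.e.symm) (a'.e (a.e.symm (a.e b))) (v i))
      rw [a.e.left_inv h, ← a'.dE_dESymm' a h' h, a.dESymm_dE h]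

variable (X G) in
/-- The first jet bundle `J¹τ` of `τ : B → M`. -/
abbrev J1 (τ : B → M) : Type _ := FibTotal (JetAt X G τ)

variable (X G) in
/-- The projection `J¹τ → B`. -/
def J1.proj (τ : B → M) (p : J1 X G τ) : B := p.pt

variable (X G) in
/-- The projection `J¹τ → M`. -/
def J1.base (τ : B → M) (p : J1 X G τ) : M := τ p.pt

section J1
variable (τ : B → M) [IsManifold 𝓘(ℝ, X × G) ∞ B] [IsManifold 𝓘(ℝ, X) ∞ M] [Fibered X G τ]

instance : TopologicalSpace (J1 X G τ) := (jetModel X G τ).core.toTopologicalSpace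

instance : ChartedSpace (X × (G × (X →L[ℝ] G))) (J1 X G τ) := (jetModel X G τ).core.toChartedSpace

instance : IsManifold 𝓘(ℝ, X × (G × (X →L[ℝ] G))) ∞ (J1 X G τ) := (jetModel X G τ).isManifold_core

instance : Fibered X (G × (X →L[ℝ] G)) (J1.base X G τ) := (jetModel X G τ).fibered_core

end J1

variable (X G) in
/-- The extended multimomentum bundle `ℳτ = Λ₁ᵐT*B` of `τ : B → M`: the bundle of `m`-forms on `B`
that vanish by the action of two `τ`-vertical vectors. -/
abbrev Mom (m : ℕ) (τ : B → M) : Type _ := FibTotal (MomAt X G m τ)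

variable (X G) in
/-- The projection `ℳτ → B`. -/
def Mom.proj (m : ℕ) (τ : B → M) (p : Mom X G m τ) : B := p.pt

variable (X G) in
/-- The projection `ℳτ → M`. -/
def Mom.base (m : ℕ) (τ : B → M) (p : Mom X G m τ) : M := τ p.pt

section Mom
variable (m : ℕ) (τ : B → M) [IsManifold 𝓘(ℝ, X × G) ∞ B] [IsManifold 𝓘(ℝ, X) ∞ M] [Fibered X G τ]
  [FiniteDimensional ℝ X] [FiniteDimensional ℝ G]

instance : TopologicalSpace (Mom X G m τ) := (momModel X G m τ).core.toTopologicalSpace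

instance : ChartedSpace (X × (G × momSpace X G m)) (Mom X G m τ) :=
  (momModel X G m τ).core.toChartedSpace

instance : IsManifold 𝓘(ℝ, X × (G × momSpace X G m)) ∞ (Mom X G m τ) :=
  (momModel X G m τ).isManifold_core

instance : Fibered X (G × momSpace X G m) (Mom.base X G m τ) := (momModel X G m τ).fibered_core

end Mom
end Fibered

/-! ## Differential forms -/

section Forms
variable {V A : Type*} [NormedAddCommGroup V] [NormedSpace ℝ V] [TopologicalSpace A]
  [ChartedSpace V A] {k : ℕ}

variable (V A) in
/-- A (not necessarily smooth) differential `k`-form on the manifold `A`. -/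
abbrev DForm (k : ℕ) : Type _ := ∀ p : A, TangentSpace 𝓘(ℝ, V) p [⋀^Fin k]→L[ℝ] ℝ

/-- The expression of the form `θ` in the preferred chart at `p`. -/
def DForm.rep (θ : DForm V A k) (p : A) (u : V) : V [⋀^Fin k]→L[ℝ] ℝ :=
  (θ ((chartAt V p).symm u)).compContinuousLinearMap
    (mfderiv 𝓘(ℝ, V) 𝓘(ℝ, V) (chartAt V p).symm u)

/-- Smoothness of a differential form: its local expressions are smooth. -/
def DForm.Smooth (θ : DForm V A k) : Prop :=
  ∀ p, ContDiffOn ℝ ∞ (θ.rep p) (chartAt V p).target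

/-- The exterior derivative, computed at `p` in the preferred chart at `p`. -/
def DForm.d (θ : DForm V A k) : DForm V A (k + 1) := fun p =>
  (extDeriv (θ.rep p) (chartAt V p p)).compContinuousLinearMap
    (mfderiv 𝓘(ℝ, V) 𝓘(ℝ, V) (chartAt V p) p)

end Forms

section Insert
variable {V W : Type*} [AddCommGroup V] [Module ℝ V] [TopologicalSpace V]
  [AddCommGroup W] [Module ℝ W] [TopologicalSpace W] {k : ℕ}

/-- The alternating form `(v₁, …, v_k) ↦ ∑ i, β (A v₁, …, P vᵢ, …, A v_k)`. -/
def insertDer (β : W [⋀^Fin k]→L[ℝ] ℝ) (A P : V →L[ℝ] W) : V [⋀^Fin k]→L[ℝ] ℝ where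
  toContinuousMultilinearMap := ∑ i, β.toContinuousMultilinearMap.compContinuousLinearMap
    (Function.update (fun _ => A) i P)
  map_eq_zero_of_eq' := by
    intro v i j hv hij
    change (∑ l, β.toContinuousMultilinearMap.compContinuousLinearMap
      (Function.update (fun _ => A) l P)) v = 0
    rw [sum_apply]
    have hc : ∀ l, (β.toContinuousMultilinearMap.compContinuousLinearMap
        (Function.update (fun _ => A) l P)) v =
          β (Function.update (fun n => A (v n)) l (P (v l))) := by
      intro l
      change β (fun n => (Function.update (fun _ => A) l P : Fin k → V →L[ℝ] W) n (v n)) = _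
      congr 1
      funext n
      by_cases h : n = l
      · subst h; simp
      · simp [h]
    simp only [hc]
    rw [Finset.sum_eq_add_of_mem i j (Finset.mem_univ _) (Finset.mem_univ _) hij]
    · have h1 : Function.update (fun n => A (v n)) j (P (v j)) =
          Function.update (fun n => A (v n)) i (P (v i)) ∘ Equiv.swap i j := by
        funext n
        by_cases hi : n = i
        · subst hi; simp [hij, hij.symm, hv]
        · by_cases hj : n = j
          · subst hj; simp [hv]
          · simp [hi, hj, Equiv.swap_apply_of_ne_of_ne hi hj]
      rw [h1]
      have := β.toAlternatingMap.map_swap (Function.update (fun n => A (v n)) i (P (v i))) hij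
      have h2 : β (Function.update (fun n => A (v n)) i (P (v i)) ∘ Equiv.swap i j) =
        - β (Function.update (fun n => A (v n)) i (P (v i))) := this
      rw [h2]
      simp
    · intro l _ hl
      refine β.toAlternatingMap.map_eq_zero_of_eq _ (i := i) (j := j) ?_ hij
      simp [hl.1.symm, hl.2.symm, hv]

theorem insertDer_apply (β : W [⋀^Fin k]→L[ℝ] ℝ) (A P : V →L[ℝ] W) (v : Fin k → V) :
    insertDer β A P v = ∑ i, β (Function.update (fun n => A (v n)) i (P (v i))) := by
  change (∑ l, β.toContinuousMultilinearMap.compContinuousLinearMap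
    (Function.update (fun _ => A) l P)) v = _
  rw [sum_apply]
  refine Finset.sum_congr rfl fun l _ => ?_
  change β (fun n => (Function.update (fun _ => A) l P : Fin k → V →L[ℝ] W) n (v n)) = _
  congr 1
  funext n
  by_cases h : n = l
  · subst h; simp
  · simp [h]

end Insert

/-! ## The Lagrangian system and the extended Legendre map -/

/-- The model of the base manifold `M` (`n = m`) and of the fibres of `π : E → M` (`n = N`). -/
abbrev Euc (n : ℕ) : Type := EuclideanSpace ℝ (Fin n)

/-- The model of the fibres of `J¹E → M`. -/
abbrev JetFib (m N : ℕ) : Type := Euc N × (Euc m →L[ℝ] Euc N)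

/-- The model of the fibres of `ℳπ → M`. -/
abbrev MomFib (m N : ℕ) : Type := Euc N × momSpace (Euc m) (Euc N) m

section Lagrangian
variable {m N : ℕ} {M E : Type*} [TopologicalSpace M] [ChartedSpace (Euc m) M]
  [IsManifold 𝓘(ℝ, Euc m) ∞ M] [TopologicalSpace E]
  [ChartedSpace (Euc m × Euc N) E]
  [IsManifold 𝓘(ℝ, Euc m × Euc N) ∞ E]

variable (π : E → M)

/-- The 1-jet obtained from `p = (y, σ)` by adding to `σ` the `π`-vertical part
`A - σ ∘ T_yπ ∘ A` of `A : T_xM → T_yE`; the fibre `J¹_yE` is an affine space over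
`T*_xM ⊗ V_y(π)`. -/
def shiftJet (p : J1 (Euc m) (Euc N) π) (A : Euc m →L[ℝ] Euc m × Euc N) : J1 (Euc m) (Euc N) π :=
  let T : TangentSpace 𝓘(ℝ, Euc m × Euc N) p.pt →L[ℝ] TangentSpace 𝓘(ℝ, Euc m) (π p.pt) :=
    mfderiv 𝓘(ℝ, Euc m × Euc N) 𝓘(ℝ, Euc m) π p.pt
  let A' : TangentSpace 𝓘(ℝ, Euc m) (π p.pt) →L[ℝ] TangentSpace 𝓘(ℝ, Euc m × Euc N) p.pt := A
  ⟨p.pt, p.val.1 + (A' - p.val.1.comp (T.comp A')), fun v => by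
    have h1 := p.val.2 v
    have h2 := p.val.2 (T (A' v))
    change T _ = v at h1
    change T _ = _ at h2
    change T (p.val.1 v + (A' v - p.val.1 (T (A' v)))) = v
    rw [map_add, map_sub, h1, h2, sub_self, add_zero]⟩

variable [Fibered (Euc m) (Euc N) π]

/-- The derivative of the Lagrangian function `L` at `p = (y, σ)` along the fibre `J¹_yE`, evaluated
at the `π`-vertical part of `A : T_xM → T_yE`. -/
def fibreDeriv (L : J1 (Euc m) (Euc N) π → ℝ) (p : J1 (Euc m) (Euc N) π) :
    (Euc m →L[ℝ] Euc m × Euc N) →L[ℝ] ℝ :=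
  fderiv ℝ (fun A => L (shiftJet π p A)) 0

/-- The linear map `P : T_yE → T_xM` with `ξ (P u) = dL (ξ ⊗ uᵛ)` for all `ξ : T*_xM`, where
`uᵛ = u - σ (T_yπ u)` is the `π`-vertical part of `u` at `p = (y, σ)` and `dL` the derivative of `L`
along `J¹_yE`. In coordinates `P = ∂L/∂v^A_α (dy^A - v^A_ν dx^ν) ⊗ ∂/∂x^α`, that is, `P` is the
derivative of `L` contracted with the vertical endomorphism `𝒱`. -/
def momentum (L : J1 (Euc m) (Euc N) π → ℝ) (p : J1 (Euc m) (Euc N) π) :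
    TangentSpace 𝓘(ℝ, Euc m × Euc N) p.pt →L[ℝ] TangentSpace 𝓘(ℝ, Euc m) (π p.pt) :=
  let P : Euc m × Euc N →L[ℝ] Euc m := ∑ α : Fin m,
    ((fibreDeriv π L p).comp (ContinuousLinearMap.smulRightL ℝ (Euc m) (Euc m × Euc N)
      (EuclideanSpace.proj α))).smulRight (EuclideanSpace.single α 1)
  P

/-- The `m`-form `i(𝒱)ℒ + ℒ` at `p = (y, σ)` for the Lagrangian density `ℒ = L π̄¹*ω`. It is
`π¹`-semibasic, and is here written as a form on `T_yE`; in coordinates with `ω = dx¹ ∧ … ∧ dxᵐ` it is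
`∂L/∂v^A_α dy^A ∧ d^{m-1}x_α - (∂L/∂v^A_α v^A_α - L) dᵐx`. -/
def legendreForm (vol : DForm (Euc m) M m) (L : J1 (Euc m) (Euc N) π → ℝ) (p : J1 (Euc m) (Euc N) π) :
    TangentSpace 𝓘(ℝ, Euc m × Euc N) p.pt [⋀^Fin m]→L[ℝ] ℝ :=
  let T : TangentSpace 𝓘(ℝ, Euc m × Euc N) p.pt →L[ℝ] TangentSpace 𝓘(ℝ, Euc m) (π p.pt) :=
    mfderiv 𝓘(ℝ, Euc m × Euc N) 𝓘(ℝ, Euc m) π p.pt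
  insertDer (vol (π p.pt)) T (momentum π L p) +
    L p • (vol (π p.pt)).compContinuousLinearMap T

/-- The extended Legendre map `J¹E → ℳπ`: its value at `p` is the `m`-form on `T_yE` from which
`Θ_ℒ` at `p` is obtained by pull-back. -/
def legendre (vol : DForm (Euc m) M m) (L : J1 (Euc m) (Euc N) π → ℝ) (p : J1 (Euc m) (Euc N) π) :
    Mom (Euc m) (Euc N) m π :=
  ⟨p.pt, legendreForm π vol L p, by
    intro v i j hij hi hj
    let T : TangentSpace 𝓘(ℝ, Euc m × Euc N) p.pt →L[ℝ] TangentSpace 𝓘(ℝ, Euc m) (π p.pt) :=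
      mfderiv 𝓘(ℝ, Euc m × Euc N) 𝓘(ℝ, Euc m) π p.pt
    change T (v i) = 0 at hi
    change T (v j) = 0 at hj
    change insertDer (vol (π p.pt)) T (momentum π L p) v +
      L p • (vol (π p.pt)) (fun n => T (v n)) = 0
    rw [(vol (π p.pt)).map_coord_zero (m := fun n => T (v n)) i hi, insertDer_apply]
    rw [smul_zero, add_zero]
    refine Finset.sum_eq_zero fun l _ => ?_
    by_cases hl : l = i
    · exact (vol (π p.pt)).map_coord_zero j (by simp [hl, hij.symm, hj])
    · exact (vol (π p.pt)).map_coord_zero i (by simp [Ne.symm hl, hi])⟩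


/-- The Poincaré–Cartan `m`-form `Θ_ℒ = i(𝒱)ℒ + ℒ` on `J¹E`. -/
def thetaL (vol : DForm (Euc m) M m) (L : J1 (Euc m) (Euc N) π → ℝ) :
    DForm (Euc m × JetFib m N) (J1 (Euc m) (Euc N) π) m := fun p =>
  (legendreForm π vol L p).compContinuousLinearMap
    (mfderiv 𝓘(ℝ, Euc m × JetFib m N) 𝓘(ℝ, Euc m × Euc N)
      (J1.proj (Euc m) (Euc N) π) p)

/-- The Poincaré–Cartan `(m+1)`-form `Ω_ℒ = -dΘ_ℒ` on `J¹E`. -/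
def omegaL (vol : DForm (Euc m) M m) (L : J1 (Euc m) (Euc N) π → ℝ) :
    DForm (Euc m × JetFib m N) (J1 (Euc m) (Euc N) π) (m + 1) := fun p =>
  -(thetaL π vol L).d p

/-- The multimomentum Liouville `m`-form `Θ` on `ℳπ`. -/
def liouvilleTheta (m N : ℕ) {M E : Type*} [TopologicalSpace M]
    [ChartedSpace (Euc m) M]
    [IsManifold 𝓘(ℝ, Euc m) ∞ M] [TopologicalSpace E]
    [ChartedSpace (Euc m × Euc N) E]
    [IsManifold 𝓘(ℝ, Euc m × Euc N) ∞ E] (π : E → M)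
    [Fibered (Euc m) (Euc N) π] :
    DForm (Euc m × MomFib m N) (Mom (Euc m) (Euc N) m π) m := fun p =>
  p.val.1.compContinuousLinearMap
    (mfderiv 𝓘(ℝ, Euc m × MomFib m N) 𝓘(ℝ, Euc m × Euc N)
      (Mom.proj (Euc m) (Euc N) m π) p)

/-- The multimomentum Liouville `(m+1)`-form `Ω = -dΘ` on `ℳπ`. -/
def liouvilleOmega (m N : ℕ) {M E : Type*} [TopologicalSpace M]
    [ChartedSpace (Euc m) M]
    [IsManifold 𝓘(ℝ, Euc m) ∞ M] [TopologicalSpace E]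
    [ChartedSpace (Euc m × Euc N) E]
    [IsManifold 𝓘(ℝ, Euc m × Euc N) ∞ E] (π : E → M)
    [Fibered (Euc m) (Euc N) π] :
    DForm (Euc m × MomFib m N) (Mom (Euc m) (Euc N) m π) (m + 1) := fun p =>
  -(liouvilleTheta m N π).d p

end Lagrangian

/-! ## Jet fields, connections and multivector fields along a map

`Φ : S → B` is a map into a fibred manifold `τ : B → M`. For `Φ = id` these are the jet fields,
Ehresmann connections and `m`-vector fields on `B`; for the inclusion `Φ = j_S` of a submanifold of
`B` they are such objects given at the points of `S`; for a map `F : S → B` they are the objects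
along `F`. -/

section Along
variable {X G D : Type*} [NormedAddCommGroup X] [NormedSpace ℝ X] [NormedAddCommGroup G]
  [NormedSpace ℝ G] [NormedAddCommGroup D] [NormedSpace ℝ D]
variable {B M S : Type*} [TopologicalSpace B] [ChartedSpace (X × G) B] [TopologicalSpace M]
  [ChartedSpace X M] [IsManifold 𝓘(ℝ, X × G) ∞ B] [IsManifold 𝓘(ℝ, X) ∞ M]
  [TopologicalSpace S] [ChartedSpace D S]

variable (X G D) in
/-- `Y` is a (smooth) jet field along `Φ`, i.e. a smooth map `S → J¹τ` over `Φ`. -/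
def IsJetField (τ : B → M) [Fibered X G τ] (Φ : S → B) (Y : ∀ s, JetAt X G τ (Φ s)) : Prop :=
  ContMDiff 𝓘(ℝ, D) 𝓘(ℝ, X × (G × (X →L[ℝ] G))) ∞ (fun s => (⟨Φ s, Y s⟩ : J1 X G τ))

variable (X G D) in
/-- `C` is a (smooth) Ehresmann connection form along `Φ`: a smooth section of `τ*T*M ⊗ TB` along
`Φ`, i.e. a smooth semibasic 1-form along `Φ` with values in `TB`, whose contraction with every
`τ`-semibasic covector `ξ` is `ξ`. -/
structure IsConnection (τ : B → M) (Φ : S → B)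
    (C : ∀ s, TangentSpace 𝓘(ℝ, X) (τ (Φ s)) →L[ℝ] TangentSpace 𝓘(ℝ, X × G) (Φ s)) : Prop where
  smooth : ∀ (U : Set M) (Z : ∀ x : M, TangentSpace 𝓘(ℝ, X) x), IsOpen U →
    ContMDiffOn 𝓘(ℝ, X) 𝓘(ℝ, X).tangent ∞
      (fun x => (⟨x, Z x⟩ : TangentBundle 𝓘(ℝ, X) M)) U →
    ContMDiffOn 𝓘(ℝ, D) 𝓘(ℝ, X × G).tangent ∞
      (fun s => (⟨Φ s, C s (Z (τ (Φ s)))⟩ : TangentBundle 𝓘(ℝ, X × G) B))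
      ((fun s => τ (Φ s)) ⁻¹' U)
  semibasic : ∀ (s : S) (ξ : TangentSpace 𝓘(ℝ, X × G) (Φ s) →L[ℝ] ℝ),
    (∀ v, mfderiv 𝓘(ℝ, X × G) 𝓘(ℝ, X) τ (Φ s) v = 0 → ξ v = 0) →
      ∀ v, ξ (C s (mfderiv 𝓘(ℝ, X × G) 𝓘(ℝ, X) τ (Φ s) v)) = ξ v

/-- The pairing of a `k`-form with a `k`-vector: `⟨β, Y₁ ∧ … ∧ Y_k⟩ = β (Y₁, …, Y_k)`. -/
def pairing {T : Type*} [AddCommGroup T] [Module ℝ T] {k : ℕ} (β : T [⋀^Fin k]→ₗ[ℝ] ℝ)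
    (x : ⋀[ℝ]^k T) : ℝ :=
  exteriorPower.alternatingMapLinearEquiv β x

variable (X G D) in
/-- `K` is a non-vanishing, locally decomposable (smooth) `m`-vector field along `Φ`. -/
structure IsMultiVF (m : ℕ) (Φ : S → B)
    (K : ∀ s, ⋀[ℝ]^m (TangentSpace 𝓘(ℝ, X × G) (Φ s))) : Prop where
  locallyDecomposable : ∀ s₀ : S, ∃ U : Set S, IsOpen U ∧ s₀ ∈ U ∧
    ∃ Y : Fin m → ∀ s, TangentSpace 𝓘(ℝ, X × G) (Φ s),
      (∀ i, ContMDiffOn 𝓘(ℝ, D) 𝓘(ℝ, X × G).tangent ∞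
        (fun s => (⟨Φ s, Y i s⟩ : TangentBundle 𝓘(ℝ, X × G) B)) U) ∧
      ∀ s ∈ U, K s = exteriorPower.ιMulti ℝ m (fun i => Y i s)
  ne_zero : ∀ s, K s ≠ 0

variable (X G D) in
/-- The class `{K}` of the `m`-vector fields `f K`, `f` a non-vanishing smooth function. -/
def mvClass (m : ℕ) (Φ : S → B) (K : ∀ s, ⋀[ℝ]^m (TangentSpace 𝓘(ℝ, X × G) (Φ s))) :
    Set (∀ s, ⋀[ℝ]^m (TangentSpace 𝓘(ℝ, X × G) (Φ s))) :=
  {K' | ∃ f : S → ℝ, ContMDiff 𝓘(ℝ, D) 𝓘(ℝ, ℝ) ∞ f ∧ (∀ s, f s ≠ 0) ∧ ∀ s, K' s = f s • K s}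

variable (X G D) in
/-- `C` is a class of non-vanishing, locally decomposable `m`-vector fields along `Φ`. -/
def IsMVFClass (m : ℕ) (Φ : S → B)
    (C : Set (∀ s, ⋀[ℝ]^m (TangentSpace 𝓘(ℝ, X × G) (Φ s)))) : Prop :=
  ∃ K, IsMultiVF X G D m Φ K ∧ C = mvClass X G D m Φ K

end Along

/-! ## Contractions with forms -/

section Contraction
variable {H T : Type*} [AddCommGroup H] [Module ℝ H] [TopologicalSpace H]
  [AddCommGroup T] [Module ℝ T] [TopologicalSpace T] {k : ℕ}

/-- The contraction `i(σ)β` of a form with a 1-jet `σ : H → T` (`H = T_xM`):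
`(Z₁, …, Z_k, w) ↦ β (σ Z₁, …, σ Z_k, w)`. -/
def jetContr (σ : H →L[ℝ] T) (β : T [⋀^Fin (k + 1)]→L[ℝ] ℝ) (Z : Fin k → H) (w : T) : ℝ :=
  β (Fin.snoc (α := fun _ => T) (fun i => σ (Z i)) w)

/-- The contraction `i(x)β` of a form with a `k`-vector: for `x = Y₁ ∧ … ∧ Y_k` it is the 1-form
`w ↦ β (Y₁, …, Y_k, w)`. -/
def mvContr (x : ⋀[ℝ]^k T) (β : T [⋀^Fin (k + 1)]→L[ℝ] ℝ) (w : T) : ℝ :=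
  (-1) ^ k * pairing (β.toAlternatingMap.curryLeft w) x

/-- The contraction `i(∇)β` of a form with a connection form `∇ = C ∘ t` (`t = T_bτ`):
`(w₁, …, w_k) ↦ ∑ i, β (w₁, …, ∇ wᵢ, …, w_k)`. -/
def connContr (C : H →L[ℝ] T) (t : T →L[ℝ] H) (β : T [⋀^Fin k]→L[ℝ] ℝ) : T [⋀^Fin k]→L[ℝ] ℝ :=
  insertDer β (ContinuousLinearMap.id ℝ T) (C.comp t)

end Contraction

/-! ## Euler–Lagrange objects and extended field operators

All notions are taken on a submanifold `j : S → J¹E`, that is, at the points of `S`. The objects on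
`J¹E` are given along `j` and those along the extended Legendre map are given along its composition
with `j`. The global notions are the case `S = J¹E`, `j = id`, and global objects yield objects on
`S` by composition with `j`. -/

section Operators
variable {m N : ℕ} {M E : Type*} [TopologicalSpace M] [ChartedSpace (Euc m) M]
  [IsManifold 𝓘(ℝ, Euc m) ∞ M] [TopologicalSpace E]
  [ChartedSpace (Euc m × Euc N) E]
  [IsManifold 𝓘(ℝ, Euc m × Euc N) ∞ E]
  {D S : Type*} [NormedAddCommGroup D] [NormedSpace ℝ D] [TopologicalSpace S] [ChartedSpace D S]

variable (m N) in
/-- Tangent map of `π¹ : J¹E → E`. -/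
def dJ1Proj (π : E → M) [Fibered (Euc m) (Euc N) π] (p : J1 (Euc m) (Euc N) π) :
    TangentSpace 𝓘(ℝ, Euc m × JetFib m N) p →L[ℝ] TangentSpace 𝓘(ℝ, Euc m × Euc N) p.pt :=
  mfderiv 𝓘(ℝ, Euc m × JetFib m N) 𝓘(ℝ, Euc m × Euc N) (J1.proj (Euc m) (Euc N) π) p

variable (m N) in
/-- Tangent map of `π̄¹ : J¹E → M`. -/
def dJ1Base (π : E → M) [Fibered (Euc m) (Euc N) π] (p : J1 (Euc m) (Euc N) π) :
    TangentSpace 𝓘(ℝ, Euc m × JetFib m N) p →L[ℝ] TangentSpace 𝓘(ℝ, Euc m) (π p.pt) :=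
  mfderiv 𝓘(ℝ, Euc m × JetFib m N) 𝓘(ℝ, Euc m) (J1.base (Euc m) (Euc N) π) p

variable (m N) in
/-- Tangent map of `τ¹ ∘ μ : ℳπ → E`. -/
def dMomProj (π : E → M) [Fibered (Euc m) (Euc N) π] (p : Mom (Euc m) (Euc N) m π) :
    TangentSpace 𝓘(ℝ, Euc m × MomFib m N) p →L[ℝ] TangentSpace 𝓘(ℝ, Euc m × Euc N) p.pt :=
  mfderiv 𝓘(ℝ, Euc m × MomFib m N) 𝓘(ℝ, Euc m × Euc N) (Mom.proj (Euc m) (Euc N) m π) p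

variable (m N) in
/-- Tangent map of `τ̄¹ ∘ μ : ℳπ → M`. -/
def dMomBase (π : E → M) [Fibered (Euc m) (Euc N) π] (p : Mom (Euc m) (Euc N) m π) :
    TangentSpace 𝓘(ℝ, Euc m × MomFib m N) p →L[ℝ] TangentSpace 𝓘(ℝ, Euc m) (π p.pt) :=
  mfderiv 𝓘(ℝ, Euc m × MomFib m N) 𝓘(ℝ, Euc m) (Mom.base (Euc m) (Euc N) m π) p

/-- Tangent map of the extended Legendre map. -/
def dLegendre (π : E → M) [Fibered (Euc m) (Euc N) π] (vol : DForm (Euc m) M m)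
    (L : J1 (Euc m) (Euc N) π → ℝ) (p : J1 (Euc m) (Euc N) π) :
    TangentSpace 𝓘(ℝ, Euc m × JetFib m N) p →L[ℝ]
      TangentSpace 𝓘(ℝ, Euc m × MomFib m N) (legendre π vol L p) :=
  mfderiv 𝓘(ℝ, Euc m × JetFib m N) 𝓘(ℝ, Euc m × MomFib m N) (legendre π vol L) p

variable (π : E → M) [Fibered (Euc m) (Euc N) π] (vol : DForm (Euc m) M m)
  (L : J1 (Euc m) (Euc N) π → ℝ) (D) (j : S → J1 (Euc m) (Euc N) π)

/-- `j : S → J¹E` is a `π̄¹`-transverse (possibly only immersed) submanifold of `J¹E`. -/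
structure IsTransverseSubmanifold : Prop where
  injective : Function.Injective j
  immersion : IsImmersion 𝓘(ℝ, D) 𝓘(ℝ, Euc m × JetFib m N) ∞ j
  transverse : ∀ s, LinearMap.range (mfderiv 𝓘(ℝ, D) 𝓘(ℝ, Euc m × JetFib m N) j s).toLinearMap ⊔
    LinearMap.ker (dJ1Base m N π (j s)).toLinearMap = ⊤

/-- Maps `S → J¹J¹E` over `j`. -/
abbrev JetOnJ1 : Type _ := ∀ s, JetAt (Euc m) (JetFib m N) (J1.base (Euc m) (Euc N) π) (j s)

/-- Maps `S → J¹ℳπ` over the restriction to `S` of the extended Legendre map. -/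
abbrev JetOnMom : Type _ :=
  ∀ s, JetAt (Euc m) (MomFib m N) (Mom.base (Euc m) (Euc N) m π) (legendre π vol L (j s))

/-- Maps `S → ΛᵐTJ¹E` over `j`. -/
abbrev MVOnJ1 : Type _ := ∀ s, ⋀[ℝ]^m (TangentSpace 𝓘(ℝ, Euc m × JetFib m N) (j s))

/-- Maps `S → ΛᵐTℳπ` over the restriction to `S` of the extended Legendre map. -/
abbrev MVOnMom : Type _ :=
  ∀ s, ⋀[ℝ]^m (TangentSpace 𝓘(ℝ, Euc m × MomFib m N) (legendre π vol L (j s)))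

/-- Maps `S → T*M ⊗ TJ¹E` over `j`. -/
abbrev ConnOnJ1 : Type _ :=
  ∀ s, TangentSpace 𝓘(ℝ, Euc m) (π (j s).pt) →L[ℝ] TangentSpace 𝓘(ℝ, Euc m × JetFib m N) (j s)

/-- Maps `S → T*M ⊗ Tℳπ` over the restriction to `S` of the extended Legendre map. -/
abbrev ConnOnMom : Type _ :=
  ∀ s, TangentSpace 𝓘(ℝ, Euc m) (π (j s).pt) →L[ℝ]
    TangentSpace 𝓘(ℝ, Euc m × MomFib m N) (legendre π vol L (j s))

/-- `Ψ` is a jet field on `S`. -/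
def IsJetFieldOn (Ψ : JetOnJ1 π j) : Prop :=
  IsJetField (Euc m) (JetFib m N) D (J1.base (Euc m) (Euc N) π) j Ψ

/-- `C` is an Ehresmann connection form of `π̄¹ : J¹E → M` on `S`. -/
def IsConnectionOn (C : ConnOnJ1 π j) : Prop :=
  IsConnection (Euc m) (JetFib m N) D (J1.base (Euc m) (Euc N) π) j C

/-- `C` is a class of non-vanishing, locally decomposable `m`-vector fields of `J¹E` on `S`. -/
def IsMVFClassOn (C : Set (MVOnJ1 π j)) : Prop :=
  IsMVFClass (Euc m) (JetFib m N) D m j C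

/-- `Ψ` is an Euler–Lagrange jet field on `S`. -/
structure IsELJetField (Ψ : JetOnJ1 π j) : Prop where
  structural : IsJetFieldOn D π j Ψ
  semiholonomic : ∀ s, (dJ1Proj m N π (j s)).comp (Ψ s).1 = (j s).val.1
  field_eq : ∀ s Z w, jetContr (Ψ s).1 (omegaL π vol L (j s)) Z w = 0

/-- `Y` is an extended jet field operator on `S`. -/
structure IsExtJetFieldOperator (Y : JetOnMom π vol L j) : Prop where
  structural : IsJetField (Euc m) (MomFib m N) D (Mom.base (Euc m) (Euc N) m π)
    (fun s => legendre π vol L (j s)) Y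
  field_eq : ∀ s Z w, jetContr (Y s).1 (liouvilleOmega m N π (legendre π vol L (j s))) Z
    (dLegendre π vol L (j s) w) = 0
  semiholonomic : ∀ s, (dMomProj m N π (legendre π vol L (j s))).comp (Y s).1 = (j s).val.1

/-- `K` is an Euler–Lagrange `m`-vector field on `S`. Semi-holonomy says that the projective class of
`Λᵐ(Tπ¹) K` is that of the `m`-dimensional subspace `σ(T_xM)` of `T_yE` defined by the point
`j s = (y, σ)` of `J¹E`. -/
structure IsELMultiVF (K : MVOnJ1 π j) : Prop where
  structural : IsMultiVF (Euc m) (JetFib m N) D m j K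
  transverse : ∀ s, pairing ((vol (π (j s).pt)).toAlternatingMap.compLinearMap
    (dJ1Base m N π (j s)).toLinearMap) (K s) ≠ 0
  semiholonomic : ∀ s,
    Submodule.span ℝ {exteriorPower.map m (dJ1Proj m N π (j s)).toLinearMap (K s)} =
      LinearMap.range (exteriorPower.map m (j s).val.1.toLinearMap)
  field_eq : ∀ s w, mvContr (K s) (omegaL π vol L (j s)) w = 0

/-- `K` is an extended `m`-vector field operator on `S`. -/
structure IsExtMultiVFOperator (K : MVOnMom π vol L j) : Prop where
  structural : IsMultiVF (Euc m) (MomFib m N) D m (fun s => legendre π vol L (j s)) K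
  transverse : ∀ s, pairing ((vol (π (j s).pt)).toAlternatingMap.compLinearMap
    (dMomBase m N π (legendre π vol L (j s))).toLinearMap) (K s) ≠ 0
  field_eq : ∀ s w, mvContr (K s) (liouvilleOmega m N π (legendre π vol L (j s)))
    (dLegendre π vol L (j s) w) = 0
  semiholonomic : ∀ s,
    Submodule.span ℝ
      {exteriorPower.map m (dMomProj m N π (legendre π vol L (j s))).toLinearMap (K s)} =
      LinearMap.range (exteriorPower.map m (j s).val.1.toLinearMap)

/-- `C` is a class of Euler–Lagrange `m`-vector fields on `S`. -/
def IsELClass (C : Set (MVOnJ1 π j)) : Prop :=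
  IsMVFClassOn D π j C ∧ ∀ K ∈ C, IsELMultiVF D π vol L j K

/-- `C` is a class of extended `m`-vector field operators on `S`. -/
def IsExtClass (C : Set (MVOnMom π vol L j)) : Prop :=
  IsMVFClass (Euc m) (MomFib m N) D m (fun s => legendre π vol L (j s)) C ∧
    ∀ K ∈ C, IsExtMultiVFOperator D π vol L j K

/-- `C` is an Euler–Lagrange connection on `S`. -/
structure IsELConnection (C : ConnOnJ1 π j) : Prop where
  structural : IsConnectionOn D π j C
  semiholonomic : ∀ s, (dJ1Proj m N π (j s)).comp (C s) = (j s).val.1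
  field_eq : ∀ s, connContr (C s) (dJ1Base m N π (j s)) (omegaL π vol L (j s)) =
    ((m : ℝ) - 1) • omegaL π vol L (j s)

/-- `C` is an extended connection operator on `S`. -/
structure IsExtConnectionOperator (C : ConnOnMom π vol L j) : Prop where
  structural : IsConnection (Euc m) (MomFib m N) D (Mom.base (Euc m) (Euc N) m π)
    (fun s => legendre π vol L (j s)) C
  field_eq : ∀ s, (connContr (C s) (dMomBase m N π (legendre π vol L (j s)))
      (liouvilleOmega m N π (legendre π vol L (j s))) -
        ((m : ℝ) - 1) • liouvilleOmega m N π (legendre π vol L (j s))).compContinuousLinearMap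
          (dLegendre π vol L (j s)) = 0
  semiholonomic : ∀ s, (dMomProj m N π (legendre π vol L (j s))).comp (C s) = (j s).val.1

/-- The relation `j¹F ∘ Ψ = Y` on `S`, `F` being the extended Legendre map: `j¹F` acts on the jet
of a section as composition of its tangent map with `TF`. -/
def JetRelated (Ψ : JetOnJ1 π j) (Y : JetOnMom π vol L j) : Prop :=
  ∀ s, (dLegendre π vol L (j s)).comp (Ψ s).1 = (Y s).1

/-- The relation `ΛᵐTF ∘ X = K` on `S`, `F` being the extended Legendre map. -/
def MVRelated (X : MVOnJ1 π j) (K : MVOnMom π vol L j) : Prop :=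
  ∀ s, exteriorPower.map m (dLegendre π vol L (j s)).toLinearMap (X s) = K s

/-- The relation `(id ⊗ TF) ∘ ∇_ℒ = ∇_𝒦` on `S`, `F` being the extended Legendre map. -/
def ConnRelated (C : ConnOnJ1 π j) (C' : ConnOnMom π vol L j) : Prop :=
  ∀ s, (dLegendre π vol L (j s)).comp (C s) = C' s

end Operators
end FieldOp

end

/-! Write `F` for the extended Legendre map. All three equivalences follow from two facts: `F`
covers the identity of `E`, and `Ω_ℒ = F*Ω`.

Since `κ ∘ F = π¹`, the chain rule gives `Tκ ∘ TF = Tπ¹`, and applying `Tπ` gives the same relation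
for the projections to `M`. The value of `F` at a jet is by definition the form whose pull-back
along `Tπ¹` is `Θ_ℒ`, so `Θ_ℒ = F*Θ` (`thetaL_eq_pullback`). As the exterior derivative commutes
with pull-backs (`DForm.d_pullback`), `Ω_ℒ = F*Ω` (`omegaL_eq_pullback`).

Contractions are natural: inserting `TF ∘ Ψ`, `ΛᵐTF ∘ X` or `TF ∘ ∇` into `Ω` and pulling the
remaining arguments back by `TF` is the same as inserting `Ψ`, `X` or `∇` into `F*Ω`
(`jetContr_comp`, `mvContr_map`, `connContr_comp`). Hence for related objects the two field
equations are one and the same equation. Semi-holonomy and transversality also agree on both sides,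
because they only involve the projections to `E` and `M`. This proves the direct statements. For the
converses, the object along `F` has to be the push-forward by `TF`, which gives uniqueness; for
classes one adds that two classes with a common member coincide.

What remains is that push-forwards are again smooth objects of the right kind. This rests on
smoothness of `F`, read off from its expression in adapted charts (`coord_legendre`,
`contMDiff_legendre`), and on smoothness of the prolongation `j¹F` (`contMDiff_prolong`) and of the
tangent map of `F`. A pushed-forward `m`-vector does not vanish, although `TF` may have a kernel:
its pairing with the volume form of `M` is that of the original `m`-vector. -/

noncomputable section
namespace FieldOp

/-! ### Maps between manifolds expressed in charts of the maximal atlases. -/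

section Charts
variable {V W V' W' : Type*} [NormedAddCommGroup V] [NormedSpace ℝ V]
  [TopologicalSpace W] [ChartedSpace V W] [IsManifold 𝓘(ℝ, V) ∞ W]
  [NormedAddCommGroup V'] [NormedSpace ℝ V']
  [TopologicalSpace W'] [ChartedSpace V' W'] [IsManifold 𝓘(ℝ, V') ∞ W']
  {e : OpenPartialHomeomorph W V} {e' : OpenPartialHomeomorph W' V'} {f : W → W'} {w : W}

/-- The derivative of the local expression of a map in charts of the maximal atlases. -/
theorem fderiv_localExpr (he : e ∈ IsManifold.maximalAtlas 𝓘(ℝ, V) ∞ W)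
    (he' : e' ∈ IsManifold.maximalAtlas 𝓘(ℝ, V') ∞ W') (hw : w ∈ e.source)
    (hw' : f w ∈ e'.source) (hf : MDifferentiableAt 𝓘(ℝ, V) 𝓘(ℝ, V') f w) (v : V) :
    fderiv ℝ (fun u => e' (f (e.symm u))) (e w) v =
      mfderiv 𝓘(ℝ, V') 𝓘(ℝ, V') e' (f w) (mfderiv 𝓘(ℝ, V) 𝓘(ℝ, V') f w
        (mfderiv 𝓘(ℝ, V) 𝓘(ℝ, V) e.symm (e w) v : V)) := by
  have h1 := (mdiff_chart he').mdifferentiableAt hw'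
  have h2 := (mdiff_chart he).mdifferentiableAt_symm (e.map_source hw)
  have h12 : MDifferentiableAt 𝓘(ℝ, V) 𝓘(ℝ, V') (e' ∘ f) w := h1.comp w hf
  -- The tangent spaces depend on the base point, so `e.symm (e w) = w` cannot be rewritten in
  -- place; the base point is generalised and the equality eliminated. The same device recurs below.
  have key : ∀ w' : W, w' = w → ∀ x : V, (mfderiv 𝓘(ℝ, V) 𝓘(ℝ, V') (e' ∘ f) w' x : V') =
      (mfderiv 𝓘(ℝ, V) 𝓘(ℝ, V') (e' ∘ f) w x : V') := by
    rintro _ rfl _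
    rfl
  have h3 := h12
  rw [← e.left_inv hw] at h3
  have h4 := mfderiv_comp_apply (e w) h3 h2 v
  have h5 : fderiv ℝ ((e' ∘ f) ∘ e.symm) (e w) v =
    (mfderiv 𝓘(ℝ, V) 𝓘(ℝ, V') ((e' ∘ f) ∘ e.symm) (e w) v : V') :=
    congrArg (fun L : V →L[ℝ] V' => L v) mfderiv_eq_fderiv.symm
  exact h5.trans ((h4.trans (key _ (e.left_inv hw) _)).trans (mfderiv_comp_apply w h1 hf _))

theorem contDiffAt_localExpr (he : e ∈ IsManifold.maximalAtlas 𝓘(ℝ, V) ∞ W)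
    (he' : e' ∈ IsManifold.maximalAtlas 𝓘(ℝ, V') ∞ W') (hw : w ∈ e.source)
    (hw' : f w ∈ e'.source) (hf : ContMDiffAt 𝓘(ℝ, V) 𝓘(ℝ, V') ∞ f w) :
    ContDiffAt ℝ ∞ (fun u => e' (f (e.symm u))) (e w) := by
  have h1 := contMDiffAt_of_mem_maximalAtlas he' hw'
  have h2 := contMDiffAt_symm_of_mem_maximalAtlas he (e.map_source hw)
  have h3 := h1.comp w hf
  rw [← e.left_inv hw] at h3
  exact (h3.comp (e w) h2).contDiffAt

/-- A map which is given in charts of the maximal atlases by a smooth map is smooth. -/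
theorem contMDiffAt_of_localExpr (he : e ∈ IsManifold.maximalAtlas 𝓘(ℝ, V) ∞ W)
    (he' : e' ∈ IsManifold.maximalAtlas 𝓘(ℝ, V') ∞ W') (hw : w ∈ e.source) {g : V → V'}
    (hg : ContDiffAt ℝ ∞ g (e w)) (hgw : g (e w) ∈ e'.target)
    (hfg : f =ᶠ[nhds w] fun x => e'.symm (g (e x))) :
    ContMDiffAt 𝓘(ℝ, V) 𝓘(ℝ, V') ∞ f w :=
  ((contMDiffAt_symm_of_mem_maximalAtlas he' hgw).comp w
    (hg.contMDiffAt.comp w (contMDiffAt_of_mem_maximalAtlas he hw))).congr_of_eventuallyEq hfg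

theorem eventually_chart_symm (hw : w ∈ e.source) {p : W → Prop} (h : ∀ᶠ x in nhds w, p x) :
    ∀ᶠ u in nhds (e w), p (e.symm u) := by
  have h1 := e.continuousAt_symm (e.map_source hw)
  rw [ContinuousAt, e.left_inv hw] at h1
  exact h1.eventually h

end Charts

/-! ### Pull-back of differential forms and its compatibility with the exterior derivative. -/

section Pullback
variable {V A V' A' : Type*} [NormedAddCommGroup V] [NormedSpace ℝ V]
  [TopologicalSpace A] [ChartedSpace V A] [IsManifold 𝓘(ℝ, V) ∞ A]
  [NormedAddCommGroup V'] [NormedSpace ℝ V']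
  [TopologicalSpace A'] [ChartedSpace V' A'] [IsManifold 𝓘(ℝ, V') ∞ A'] {k : ℕ}

/-- The pull-back of a differential form. -/
def DForm.pullback (f : A → A') (θ : DForm V' A' k) : DForm V A k := fun p =>
  (θ (f p)).compContinuousLinearMap (mfderiv 𝓘(ℝ, V) 𝓘(ℝ, V') f p)

/-- The expression of a form in a chart. -/
def DForm.localExpr (θ : DForm V A k) (e : OpenPartialHomeomorph A V) (u : V) : V [⋀^Fin k]→L[ℝ] ℝ :=
  (θ (e.symm u)).compContinuousLinearMap (mfderiv 𝓘(ℝ, V) 𝓘(ℝ, V) e.symm u)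

/-- The chain rule in charts: inserting `e'.symm ∘ e'` after `f` turns the tangent map of `f` into
the derivative of its local expression. With `f = id` it is the change-of-chart formula for forms.
-/
theorem DForm.localExpr_pullback {f : A → A'} (θ : DForm V' A' k)
    {e : OpenPartialHomeomorph A V} {e' : OpenPartialHomeomorph A' V'}
    (he : e ∈ IsManifold.maximalAtlas 𝓘(ℝ, V) ∞ A)
    (he' : e' ∈ IsManifold.maximalAtlas 𝓘(ℝ, V') ∞ A') {u : V} (hu : u ∈ e.target)
    (hu' : f (e.symm u) ∈ e'.source) (hf : MDifferentiableAt 𝓘(ℝ, V) 𝓘(ℝ, V') f (e.symm u)) :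
    (θ.pullback f : DForm V A k).localExpr e u =
      (θ.localExpr e' (e' (f (e.symm u)))).compContinuousLinearMap
        (fderiv ℝ (fun u => e' (f (e.symm u))) u) := by
  have key : ∀ w, w = f (e.symm u) → ∀ v : Fin k → V',
      θ w v = θ (f (e.symm u)) v := by
    rintro _ rfl _
    rfl
  ext v
  refine Eq.trans ?_ (key _ (e'.left_inv hu') _).symm
  change θ (f (e.symm u)) _ = θ (f (e.symm u)) _
  congr 1
  funext i
  have h1 := fderiv_localExpr he he' (e.map_target hu) hu' hf (v i)
  rw [e.right_inv hu] at h1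
  have h2 := mfderiv_symm_chart he' hu' (mfderiv 𝓘(ℝ, V) 𝓘(ℝ, V') f (e.symm u)
        (mfderiv 𝓘(ℝ, V) 𝓘(ℝ, V) e.symm u (v i) : V))
  refine h2.symm.trans ?_
  exact congrArg (fun z : V' => (mfderiv 𝓘(ℝ, V') 𝓘(ℝ, V') e'.symm (e' (f (e.symm u))) z : V')) h1.symm

/-- The exterior derivative commutes with pull-backs. -/
theorem DForm.d_pullback {f : A → A'} (hf : ContMDiff 𝓘(ℝ, V) 𝓘(ℝ, V') ∞ f)
    {θ : DForm V' A' k} (hθ : θ.Smooth) : (θ.pullback f : DForm V A k).d = θ.d.pullback f := by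
  funext p
  set e := chartAt V p with he_def
  set e' := chartAt V' (f p) with he_def'
  have he : e ∈ IsManifold.maximalAtlas 𝓘(ℝ, V) ∞ A := IsManifold.chart_mem_maximalAtlas p
  have he' : e' ∈ IsManifold.maximalAtlas 𝓘(ℝ, V') ∞ A' := IsManifold.chart_mem_maximalAtlas (f p)
  have hp : p ∈ e.source := mem_chart_source V p
  have hp' : f p ∈ e'.source := mem_chart_source V' (f p)
  have hrep : (θ.pullback f : DForm V A k).rep p =ᶠ[nhds (e p)] fun u =>
      (θ.rep (f p) (e' (f (e.symm u)))).compContinuousLinearMap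
        (fderiv ℝ (fun u => e' (f (e.symm u))) u) := by
    filter_upwards [e.open_target.mem_nhds (e.map_source hp), eventually_chart_symm hp
      (hf.continuous.continuousAt.eventually (e'.open_source.mem_nhds hp'))] with u hu hu'
    exact DForm.localExpr_pullback θ he he' hu hu' ((hf _).mdifferentiableAt (by simp))
  have hd : ContDiffAt ℝ ∞ (θ.rep (f p)) (e' (f p)) :=
    (hθ (f p)).contDiffAt (e'.open_target.mem_nhds (e'.map_source hp'))
  have h0 : e' (f (e.symm (e p))) = e' (f p) := by rw [e.left_inv hp]
  have hd' : DifferentiableAt ℝ (θ.rep (f p)) (e' (f (e.symm (e p)))) := by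
    rw [h0]
    exact hd.differentiableAt (by simp)
  -- On vector spaces the identity needs the local expression of `f` to be twice differentiable, by
  -- symmetry of second derivatives; this is the bound `2 ≤ ∞`.
  have hext := extDeriv_pullback (f := fun u => e' (f (e.symm u))) (r := ∞) hd'
    (contDiffAt_localExpr he he' hp hp' (hf p)) (by simpa using (WithTop.coe_le_coe.2 le_top : (2 : WithTop ℕ∞) ≤ ∞))
  change (extDeriv ((θ.pullback f : DForm V A k).rep p) (e p)).compContinuousLinearMap _ =
    ((extDeriv (θ.rep (f p)) (e' (f p))).compContinuousLinearMap _).compContinuousLinearMap _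
  rw [hrep.extDeriv_eq, hext, h0]
  ext v
  change extDeriv (θ.rep (f p)) (e' (f p)) _ = extDeriv (θ.rep (f p)) (e' (f p)) _
  congr 1
  funext i
  refine (fderiv_localExpr he he' hp hp' ((hf p).mdifferentiableAt (by simp)) _).trans ?_
  have := mfderiv_symm_chart he hp (v i)
  exact congrArg (fun z : V => (mfderiv 𝓘(ℝ, V') 𝓘(ℝ, V') e' (f p) (mfderiv 𝓘(ℝ, V) 𝓘(ℝ, V') f p z : V'))) this

end Pullback

/-! ### Smooth maps between total spaces built from fibre models. -/

section FibModelMaps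
variable {X G X' G' : Type*} [NormedAddCommGroup X] [NormedSpace ℝ X] [NormedAddCommGroup G]
  [NormedSpace ℝ G] [NormedAddCommGroup X'] [NormedSpace ℝ X'] [NormedAddCommGroup G']
  [NormedSpace ℝ G']
  {B M : Type*} [TopologicalSpace B] [ChartedSpace (X × G) B] [IsManifold 𝓘(ℝ, X × G) ∞ B]
  [TopologicalSpace M] [ChartedSpace X M]
  {B' M' : Type*} [TopologicalSpace B'] [ChartedSpace (X' × G') B'] [IsManifold 𝓘(ℝ, X' × G') ∞ B']
  [TopologicalSpace M'] [ChartedSpace X' M']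
  {τ : B → M} [Fibered X G τ] {τ' : B' → M'} [Fibered X' G' τ']
  {Fib : B → Type*} {Q : Type*} [NormedAddCommGroup Q] [NormedSpace ℝ Q]
  {Fib' : B' → Type*} {Q' : Type*} [NormedAddCommGroup Q'] [NormedSpace ℝ Q']

namespace FibModel

/-- The chart of the total space induced by an adapted chart, as a partial homeomorphism. -/
def openChart (F : FibModel X G τ Fib Q) (a : AdaptedChart X G τ) :
    letI := F.core.toTopologicalSpace
    OpenPartialHomeomorph (FibTotal Fib) (X × (G × Q)) :=
  F.core.openPartialHomeomorph (F.chart a) (mem_range_self a)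

theorem openChart_mem_maximalAtlas (F : FibModel X G τ Fib Q) (a : AdaptedChart X G τ) :
    letI := F.core.toTopologicalSpace
    letI := F.core.toChartedSpace
    F.openChart a ∈ IsManifold.maximalAtlas 𝓘(ℝ, X × (G × Q)) ∞ (FibTotal Fib) := by
  let := F.core.toTopologicalSpace
  let := F.core.toChartedSpace
  have := F.isManifold_core
  apply IsManifold.subset_maximalAtlas
  exact mem_iUnion₂.2 ⟨_, mem_range_self a, rfl⟩

/-- `core` picks its preferred charts among those induced by adapted charts. Smoothness of forms,
which is defined with preferred charts, can thus be checked in adapted coordinates. -/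
theorem exists_chartAt_eq (F : FibModel X G τ Fib Q) (p : FibTotal Fib) :
    letI := F.core.toTopologicalSpace
    letI := F.core.toChartedSpace
    ∃ a : AdaptedChart X G τ, p.pt ∈ a.e.source ∧ chartAt (X × (G × Q)) p = F.openChart a :=
  ⟨_, (Fibered.exists_chart X G (τ := τ) p.pt).choose_spec, rfl⟩

theorem contMDiff_proj (F : FibModel X G τ Fib Q) :
    letI := F.core.toTopologicalSpace
    letI := F.core.toChartedSpace
    ContMDiff 𝓘(ℝ, X × (G × Q)) 𝓘(ℝ, X × G) ∞ (fun p : FibTotal Fib => p.pt) := by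
  let := F.core.toTopologicalSpace
  let := F.core.toChartedSpace
  have := F.isManifold_core
  intro p
  obtain ⟨a, ha⟩ := Fibered.exists_chart X G (τ := τ) p.pt
  refine contMDiffAt_of_localExpr (F.openChart_mem_maximalAtlas a) a.he (w := p) ha
    (g := fun u => (u.1, u.2.1)) (by fun_prop) (a.e.map_source ha) ?_
  filter_upwards [(F.openChart a).open_source.mem_nhds ha] with q hq
  exact (a.e.left_inv hq).symm

/-- In the induced coordinates the projection is the linear map `(x, y, q) ↦ (x, y)`, which is its
own derivative. -/
theorem fderiv_proj (F : FibModel X G τ Fib Q) (a : AdaptedChart X G τ) {u : X × (G × Q)}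
    (hu : (u.1, u.2.1) ∈ a.e.target) (v : X × (G × Q)) :
    letI := F.core.toTopologicalSpace
    letI := F.core.toChartedSpace
    a.dE ((F.openChart a).symm u).pt (mfderiv 𝓘(ℝ, X × (G × Q)) 𝓘(ℝ, X × G)
      (fun p : FibTotal Fib => p.pt) ((F.openChart a).symm u)
        (mfderiv 𝓘(ℝ, X × (G × Q)) 𝓘(ℝ, X × (G × Q)) (F.openChart a).symm u v)) = (v.1, v.2.1) := by
  let := F.core.toTopologicalSpace
  let := F.core.toChartedSpace
  have := F.isManifold_core
  have hu' : u ∈ (F.openChart a).target := hu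
  have hs : ((F.openChart a).symm u).pt ∈ a.e.source := (F.openChart a).map_target hu'
  have h1 := fderiv_localExpr (F.openChart_mem_maximalAtlas a) a.he
    ((F.openChart a).map_target hu') hs ((F.contMDiff_proj _).mdifferentiableAt (by simp)) v
  rw [(F.openChart a).right_inv hu'] at h1
  refine h1.symm.trans ?_
  have h2 : (fun u => a.e ((F.openChart a).symm u).pt) =ᶠ[nhds u] fun u => (u.1, u.2.1) := by
    filter_upwards [(F.openChart a).open_target.mem_nhds hu'] with z hz
    have hz : (z.1, z.2.1) ∈ a.e.target := hz
    change a.e ((F.chart a).symm z).pt = _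
    rw [F.chart_symm_apply hz]
    exact a.e.right_inv hz
  rw [h2.fderiv_eq]
  have h3 : (fun u : X × (G × Q) => (u.1, u.2.1)) = (ContinuousLinearMap.fst ℝ X (G × Q)).prod
    ((ContinuousLinearMap.fst ℝ G Q).comp (ContinuousLinearMap.snd ℝ X (G × Q))) := rfl
  rw [h3, ContinuousLinearMap.fderiv]
  rfl

/-- A map of total spaces over a smooth map is smooth if it is smooth in the induced charts. -/
theorem contMDiff_map (F : FibModel X G τ Fib Q) (F' : FibModel X' G' τ' Fib' Q') {f : B → B'}
    (hf : ContMDiff 𝓘(ℝ, X × G) 𝓘(ℝ, X' × G') ∞ f) (φ : ∀ b, Fib b → Fib' (f b))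
    (h : ∀ b (g : Fib b), ∃ (a : AdaptedChart X G τ) (a' : AdaptedChart X' G' τ')
      (hb : b ∈ a.e.source) (_ : f b ∈ a'.e.source) (T : (X × G) × Q → Q'),
      ContDiffAt ℝ ∞ T (a.e b, F.coord a b hb g) ∧
      ∀ b₁ (h₁ : b₁ ∈ a.e.source) (h₁' : f b₁ ∈ a'.e.source) (g₁ : Fib b₁),
        F'.coord a' (f b₁) h₁' (φ b₁ g₁) = T (a.e b₁, F.coord a b₁ h₁ g₁)) :
    letI := F.core.toTopologicalSpace
    letI := F.core.toChartedSpace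
    letI := F'.core.toTopologicalSpace
    letI := F'.core.toChartedSpace
    ContMDiff 𝓘(ℝ, X × (G × Q)) 𝓘(ℝ, X' × (G' × Q')) ∞
      (fun p : FibTotal Fib => (⟨f p.pt, φ p.pt p.val⟩ : FibTotal Fib')) := by
  let := F.core.toTopologicalSpace
  let := F.core.toChartedSpace
  let := F'.core.toTopologicalSpace
  let := F'.core.toChartedSpace
  have := F.isManifold_core
  have := F'.isManifold_core
  rintro ⟨b, g⟩
  obtain ⟨a, a', hb, hb', T, hT, hTeq⟩ := h b g
  have hlocal := contDiffAt_localExpr a.he a'.he hb hb' (hf b)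
  have happ : ∀ b₁ (h₁ : b₁ ∈ a.e.source) (g₁ : Fib b₁), F.openChart a ⟨b₁, g₁⟩ =
    ((a.e b₁).1, (a.e b₁).2, F.coord a b₁ h₁ g₁) := fun b₁ h₁ g₁ => F.chart_apply h₁
  have happ' : ∀ b₁ (h₁ : b₁ ∈ a'.e.source) (g₁ : Fib' b₁), F'.openChart a' ⟨b₁, g₁⟩ =
    ((a'.e b₁).1, (a'.e b₁).2, F'.coord a' b₁ h₁ g₁) := fun b₁ h₁ g₁ => F'.chart_apply h₁
  -- In induced charts the map has the local expression of `f` as its base part and `T` as its fibre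
  -- part.
  have hval : ∀ b₁ (h₁ : b₁ ∈ a.e.source) (h₁' : f b₁ ∈ a'.e.source) (g₁ : Fib b₁),
      F'.openChart a' ⟨f b₁, φ b₁ g₁⟩ = (fun u : X × (G × Q) =>
        ((a'.e (f (a.e.symm (u.1, u.2.1)))).1, (a'.e (f (a.e.symm (u.1, u.2.1)))).2,
          T ((u.1, u.2.1), u.2.2))) (F.openChart a ⟨b₁, g₁⟩) := by
    intro b₁ h₁ h₁' g₁
    rw [happ b₁ h₁ g₁, happ' _ h₁' _, hTeq b₁ h₁ h₁' g₁]
    simp [a.e.left_inv h₁]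
  have hsrc : (⟨f b, φ b g⟩ : FibTotal Fib') ∈ (F'.openChart a').source := hb'
  refine contMDiffAt_of_localExpr (F.openChart_mem_maximalAtlas a)
    (F'.openChart_mem_maximalAtlas a') (w := ⟨b, g⟩) hb (g := fun u : X × (G × Q) =>
        ((a'.e (f (a.e.symm (u.1, u.2.1)))).1, (a'.e (f (a.e.symm (u.1, u.2.1)))).2,
          T ((u.1, u.2.1), u.2.2))) ?_ ?_ ?_
  · rw [happ b hb g]
    have h1 : ContDiffAt ℝ ∞ (fun u : X × (G × Q) => a'.e (f (a.e.symm (u.1, u.2.1))))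
        ((a.e b).1, (a.e b).2, F.coord a b hb g) :=
      ContDiffAt.comp (g := fun z => a'.e (f (a.e.symm z)))
        (f := fun u : X × (G × Q) => (u.1, u.2.1)) _ hlocal (by fun_prop)
    have h2 : ContDiffAt ℝ ∞ (fun u : X × (G × Q) => T ((u.1, u.2.1), u.2.2))
        ((a.e b).1, (a.e b).2, F.coord a b hb g) :=
      ContDiffAt.comp (g := T) (f := fun u : X × (G × Q) => ((u.1, u.2.1), u.2.2)) _ hT (by fun_prop)
    exact h1.fst.prodMk (h1.snd.prodMk h2)
  · have := (F'.openChart a').map_source hsrc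
    rwa [hval b hb hb' g] at this
  · have hc : ContinuousAt (fun p : FibTotal Fib => f p.pt) ⟨b, g⟩ :=
      (hf.continuous.comp F.contMDiff_proj.continuous).continuousAt
    filter_upwards [(F.openChart a).open_source.mem_nhds (show (⟨b, g⟩ : FibTotal Fib) ∈ _ from hb),
      hc.eventually (a'.e.open_source.mem_nhds hb')] with q hq hq'
    obtain ⟨b₁, g₁⟩ := q
    exact ((F'.openChart a').left_inv hq').symm.trans
      (congrArg (F'.openChart a').symm (hval b₁ hq hq' g₁))

end FibModel
end FibModelMaps

/-! ### Smoothness criteria for maps with values in spaces of forms. -/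

section Calculus
variable {U : Type*} [NormedAddCommGroup U] [NormedSpace ℝ U]

/-- A map into a finite-dimensional space is smooth if its compositions with a separating family of
functionals are smooth. -/
theorem contDiffAt_of_separating {Q ι : Type*} [NormedAddCommGroup Q] [NormedSpace ℝ Q]
    [FiniteDimensional ℝ Q] (l : ι → Q →ₗ[ℝ] ℝ) (hl : ∀ q, (∀ i, l i q = 0) → q = 0) {f : U → Q}
    {u : U} (hf : ∀ i, ContDiffAt ℝ ∞ (fun x => l i (f x)) u) : ContDiffAt ℝ ∞ f u := by
  have hφ : ∀ φ : Q →ₗ[ℝ] ℝ, ContDiffAt ℝ ∞ (fun x => φ (f x)) u := by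
    intro φ
    -- The functionals `l i` have zero common kernel, so in finite dimension they span the dual;
    -- smoothness then passes to every functional by linearity, in particular to coordinates.
    have h1 : φ ∈ Submodule.span ℝ (range l) := by
      refine FiniteDimensional.mem_span_of_iInf_ker_le_ker fun q hq => ?_
      have : q = 0 := hl q fun i => by simpa using (Submodule.mem_iInf _).1 hq i
      simp [this]
    induction h1 using Submodule.span_induction with
    | mem φ h =>
      obtain ⟨i, rfl⟩ := h
      exact hf i
    | zero => simpa using contDiffAt_const
    | add φ ψ _ _ h h' => simpa using h.add h'
    | smul c φ _ h => simpa using contDiffAt_const.mul h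
  let b := Module.finBasis ℝ Q
  have h2 : f = fun x => ∑ i, b.coord i (f x) • b i := by
    funext x
    simp [b.sum_repr]
  rw [h2]
  exact ContDiffAt.sum fun i _ => (hφ (b.coord i)).smul contDiffAt_const

variable {V : Type*} [NormedAddCommGroup V] [NormedSpace ℝ V] {k : ℕ}

/-- A vector `w` is the value at `1` of the linear map `t ↦ t w`. Evaluation at `w₁, …, w_k` is
therefore precomposition with such maps, which is multilinear in them, followed by evaluation at
`(1, …, 1)`. -/
theorem contDiffAt_alternating_apply {β : U → V [⋀^Fin k]→L[ℝ] ℝ} {w : Fin k → U → V} {u : U}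
    (hβ : ContDiffAt ℝ ∞ β u) (hw : ∀ i, ContDiffAt ℝ ∞ (w i) u) :
    ContDiffAt ℝ ∞ (fun x => β x fun i => w i x) u := by
  have h1 : ContDiffAt ℝ ∞ (fun x => (β x).toContinuousMultilinearMap) u :=
    (ContinuousAlternatingMap.toContinuousMultilinearMapLI (𝕜 := ℝ) (E := V) (F := ℝ)
      (ι := Fin k)).toContinuousLinearMap.contDiff.contDiffAt.comp u hβ
  have h2 : ContDiffAt ℝ ∞ (fun x => fun i => ContinuousLinearMap.toSpanSingleton ℝ (w i x)) u :=
    contDiffAt_pi.2 fun i => (ContinuousLinearMap.toSpanSingletonCLE (𝕜 := ℝ) (E := V)).contDiff.contDiffAt.comp u (hw i)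
  have h3 := (((ContinuousMultilinearMap.compContinuousLinearMapContinuousMultilinear ℝ
      (fun _ : Fin k => ℝ) (fun _ => V) ℝ).contDiff (n := ∞)).contDiffAt.comp u h2).clm_apply h1
  have h4 := (ContinuousMultilinearMap.apply ℝ (fun _ : Fin k => ℝ) ℝ
    (fun _ => 1)).contDiff.contDiffAt.comp u h3
  refine h4.congr_of_eventuallyEq (Filter.Eventually.of_forall fun x => ?_)
  change β x (fun i => w i x) = β x (fun i => ContinuousLinearMap.toSpanSingleton ℝ (w i x) 1)
  simp

theorem finiteDimensional_alternating [FiniteDimensional ℝ V] :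
    FiniteDimensional ℝ (V [⋀^Fin k]→L[ℝ] ℝ) := by
  have : FiniteDimensional ℝ (ContinuousMultilinearMap ℝ (fun _ : Fin k => V) ℝ) :=
    Module.Finite.of_injective (ContinuousMultilinearMap.toMultilinearMapLinear :
      ContinuousMultilinearMap ℝ (fun _ : Fin k => V) ℝ →ₗ[ℝ]
        MultilinearMap ℝ (fun _ : Fin k => V) ℝ)
      ContinuousMultilinearMap.toMultilinearMap_injective
  exact Module.Finite.of_injective (ContinuousAlternatingMap.toContinuousMultilinearMapLI (𝕜 := ℝ)
    (E := V) (F := ℝ) (ι := Fin k)).toLinearMap (LinearIsometry.injective _)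

/-- Evaluations at fixed arguments separate forms, and the space of forms is finite-dimensional, so
smoothness may be tested on constant arguments. -/
theorem contDiffAt_alternating [FiniteDimensional ℝ V] {β : U → V [⋀^Fin k]→L[ℝ] ℝ} {u : U}
    (h : ∀ v, ContDiffAt ℝ ∞ (fun x => β x v) u) : ContDiffAt ℝ ∞ β u := by
  have := finiteDimensional_alternating (V := V) (k := k)
  refine contDiffAt_of_separating (fun v : Fin k → V =>
    { toFun := fun β => β v, map_add' := fun _ _ => rfl, map_smul' := fun _ _ => rfl }) ?_ h
  intro q hq
  ext v
  exact hq v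

theorem contDiffAt_momSpace {X G : Type*} [NormedAddCommGroup X] [NormedSpace ℝ X]
    [NormedAddCommGroup G] [NormedSpace ℝ G] [FiniteDimensional ℝ X] [FiniteDimensional ℝ G]
    {β : U → momSpace X G k} {u : U}
    (h : ∀ v, ContDiffAt ℝ ∞ (fun x => (β x).1 v) u) : ContDiffAt ℝ ∞ β u := by
  have := finiteDimensional_alternating (V := X × G) (k := k)
  refine contDiffAt_of_separating (fun v : Fin k → X × G =>
    { toFun := fun β : momSpace X G k => β.1 v, map_add' := fun _ _ => rfl,
      map_smul' := fun _ _ => rfl }) ?_ h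
  intro q hq
  apply Subtype.ext
  ext v
  exact hq v

/-- The expression of a smooth form in any chart of the maximal atlas is smooth. -/
theorem DForm.Smooth.contDiffAt_localExpr [FiniteDimensional ℝ V] {A : Type*} [TopologicalSpace A]
    [ChartedSpace V A] [IsManifold 𝓘(ℝ, V) ∞ A] {θ : DForm V A k} (hθ : θ.Smooth)
    {e : OpenPartialHomeomorph A V} (he : e ∈ IsManifold.maximalAtlas 𝓘(ℝ, V) ∞ A) {u : V}
    (hu : u ∈ e.target) : ContDiffAt ℝ ∞ (θ.localExpr e) u := by
  set c := chartAt V (e.symm u) with hc_def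
  have hc : c ∈ IsManifold.maximalAtlas 𝓘(ℝ, V) ∞ A := IsManifold.chart_mem_maximalAtlas _
  have hs := e.map_target hu
  have hs' : e.symm u ∈ c.source := mem_chart_source V _
  -- Smoothness is assumed in preferred charts only; viewing `θ` as its own pull-back by the
  -- identity gives the formula for passing from `c` to `e`.
  have h0 : (θ.pullback id : DForm V A k) = θ := by
    funext p
    change (θ p).compContinuousLinearMap (mfderiv 𝓘(ℝ, V) 𝓘(ℝ, V) id p) = _
    rw [mfderiv_id]
    rfl
  have h1 : θ.localExpr e =ᶠ[nhds u] fun u =>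
      (θ.localExpr c (c (e.symm u))).compContinuousLinearMap
        (fderiv ℝ (fun u => c (e.symm u)) u) := by
    filter_upwards [e.open_target.mem_nhds hu, (e.continuousAt_symm hu).eventually
      (c.open_source.mem_nhds hs')] with z hz hz'
    have := DForm.localExpr_pullback (f := id) θ he hc hz hz' mdifferentiableAt_id
    rwa [h0] at this
  have h2 : ContDiffAt ℝ ∞ (fun u => c (e.symm u)) u := by
    have := FieldOp.contDiffAt_localExpr (f := id) he hc hs hs' contMDiffAt_id
    rwa [e.right_inv hu] at this
  have h3 : ContDiffAt ℝ ∞ (fun z => θ.localExpr c (c (e.symm z))) u :=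
    ContDiffAt.comp (g := θ.localExpr c) (f := fun z => c (e.symm z)) u
      ((hθ (e.symm u)).contDiffAt (c.open_target.mem_nhds (c.map_source hs'))) h2
  have h4 : ContDiffAt ℝ ∞ (fderiv ℝ (fun u => c (e.symm u))) u := h2.fderiv_right (by simp)
  refine ContDiffAt.congr_of_eventuallyEq ?_ h1
  exact contDiffAt_alternating fun v => contDiffAt_alternating_apply
    (w := fun i x => fderiv ℝ (fun u => c (e.symm u)) x (v i)) h3
    fun i => h4.clm_apply contDiffAt_const

theorem DForm.smooth_of_contDiffAt_apply [FiniteDimensional ℝ V] {A : Type*} [TopologicalSpace A]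
    [ChartedSpace V A] {θ : DForm V A k} (h : ∀ p, ∀ u ∈ (chartAt V p).target, ∀ v,
      ContDiffAt ℝ ∞ (fun u => θ.localExpr (chartAt V p) u v) u) : θ.Smooth :=
  fun p u hu => (contDiffAt_alternating (h p u hu)).contDiffWithinAt

end Calculus

/-! ### The Liouville form in induced coordinates. -/

section Liouville
variable {X G : Type*} [NormedAddCommGroup X] [NormedSpace ℝ X] [NormedAddCommGroup G]
  [NormedSpace ℝ G] [FiniteDimensional ℝ X] [FiniteDimensional ℝ G]
  {B M : Type*} [TopologicalSpace B] [ChartedSpace (X × G) B] [IsManifold 𝓘(ℝ, X × G) ∞ B]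
  [TopologicalSpace M] [ChartedSpace X M] [IsManifold 𝓘(ℝ, X) ∞ M] (k : ℕ)
  (τ : B → M) [Fibered X G τ]

variable (X G) in
/-- The Liouville form of the bundle of momenta. -/
def Mom.theta : DForm (X × (G × momSpace X G k)) (Mom X G k τ) k := fun p =>
  p.val.1.compContinuousLinearMap
    (mfderiv 𝓘(ℝ, X × (G × momSpace X G k)) 𝓘(ℝ, X × G) (Mom.proj X G k τ) p)

/-- The tautological property of the Liouville form: the fibre coordinate of a momentum is the
momentum itself read in the chart, and the projection reads as `(x, y, q) ↦ (x, y)`. The expression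
is linear in the fibre coordinate, hence smooth. -/
theorem Mom.theta_localExpr (a : AdaptedChart X G τ) {u : X × (G × momSpace X G k)}
    (hu : u ∈ ((momModel X G k τ).openChart a).target) (v : Fin k → X × (G × momSpace X G k)) :
    (Mom.theta X G k τ).localExpr ((momModel X G k τ).openChart a) u v =
      u.2.2.1 fun i => ((v i).1, (v i).2.1) := by
  set c := (momModel X G k τ).openChart a
  have hu' : (u.1, u.2.1) ∈ a.e.target := hu
  have hpt : (c.symm u).pt ∈ a.e.source := c.map_target hu
  have h2 : (momModel X G k τ).coord a (c.symm u).pt hpt (c.symm u).val = u.2.2 := by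
    have h3 := c.right_inv hu
    have h4 := (momModel X G k τ).chart_apply (f := (c.symm u).val) hpt
    exact congrArg (fun z : X × (G × momSpace X G k) => z.2.2) (h4.symm.trans h3)
  rw [← h2]
  change (c.symm u).val.1 _ = (c.symm u).val.1 _
  congr 1
  funext i
  have h5 := (momModel X G k τ).fderiv_proj a hu' (v i)
  exact (a.dESymm_dE hpt _).symm.trans (congrArg (a.dESymm _) h5)

theorem contDiff_momSpace_apply (v : Fin k → X × (G × momSpace X G k)) :
    ContDiff ℝ ∞ (fun u : X × (G × momSpace X G k) => u.2.2.1 fun i => ((v i).1, (v i).2.1)) := by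
  have hq : ContDiff ℝ ∞ (fun u : X × (G × momSpace X G k) => u.2.2) := by fun_prop
  exact contDiff_iff_contDiffAt.2 fun _ => contDiffAt_alternating_apply
    (β := fun u : X × (G × momSpace X G k) => u.2.2.1)
    (w := fun i _ => ((v i).1, (v i).2.1))
    (ContDiff.comp (g := (momSpace X G k).subtypeL) (ContinuousLinearMap.contDiff _) hq).contDiffAt
    fun _ => contDiffAt_const

theorem Mom.theta_smooth : (Mom.theta X G k τ).Smooth := by
  have := finiteDimensional_alternating (V := X × G) (k := k)
  refine DForm.smooth_of_contDiffAt_apply fun p => ?_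
  obtain ⟨a, -, ha⟩ := (momModel X G k τ).exists_chartAt_eq p
  have ha : chartAt (X × (G × momSpace X G k)) p = (momModel X G k τ).openChart a := ha
  rw [ha]
  intro u hu v
  refine (contDiff_momSpace_apply k v).contDiffAt.congr_of_eventuallyEq ?_
  filter_upwards [((momModel X G k τ).openChart a).open_target.mem_nhds hu] with z hz
  exact Mom.theta_localExpr k τ a hz v

end Liouville

/-! ### The extended Legendre map in adapted coordinates and its smoothness. -/

section Lagrangian
variable {m N : ℕ} {M E : Type*} [TopologicalSpace M] [ChartedSpace (Euc m) M]
  [IsManifold 𝓘(ℝ, Euc m) ∞ M] [TopologicalSpace E]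
  [ChartedSpace (Euc m × Euc N) E]
  [IsManifold 𝓘(ℝ, Euc m × Euc N) ∞ E]
  (π : E → M) [Fibered (Euc m) (Euc N) π]

/-- The chart `(x, y, v)` of `J¹π` induced by an adapted chart. -/
def jetChart (a : AdaptedChart (Euc m) (Euc N) π) :
    OpenPartialHomeomorph (J1 (Euc m) (Euc N) π) (Euc m × JetFib m N) :=
  (jetModel (Euc m) (Euc N) π).openChart a

/-- The chart of `ℳπ` induced by an adapted chart. -/
def momChart (a : AdaptedChart (Euc m) (Euc N) π) :
    OpenPartialHomeomorph (Mom (Euc m) (Euc N) m π) (Euc m × MomFib m N) :=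
  (momModel (Euc m) (Euc N) m π).openChart a

theorem contMDiff_J1_proj : ContMDiff 𝓘(ℝ, Euc m × JetFib m N) 𝓘(ℝ, Euc m × Euc N) ∞
    (J1.proj (Euc m) (Euc N) π) :=
  (jetModel (Euc m) (Euc N) π).contMDiff_proj

theorem contMDiff_Mom_proj : ContMDiff 𝓘(ℝ, Euc m × MomFib m N) 𝓘(ℝ, Euc m × Euc N) ∞
    (Mom.proj (Euc m) (Euc N) m π) :=
  (momModel (Euc m) (Euc N) m π).contMDiff_proj

/-- `liouvilleTheta` unfolds to `Mom.theta` for Euclidean models and `k = m`. -/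
theorem liouvilleTheta_smooth : (liouvilleTheta m N π).Smooth :=
  Mom.theta_smooth m π

variable {π}

/-- The linear part of `A ↦ shiftJet π p A` in jet coordinates. -/
def shiftLin (a : AdaptedChart (Euc m) (Euc N) π) (p : J1 (Euc m) (Euc N) π) :
    (Euc m →L[ℝ] Euc m × Euc N) →L[ℝ] (Euc m →L[ℝ] Euc N) :=
  let R : Euc m × Euc N →L[ℝ] Euc N := (ContinuousLinearMap.snd ℝ (Euc m) (Euc N)).comp
    ((a.dE p.pt).comp (ContinuousLinearMap.id ℝ (TangentSpace 𝓘(ℝ, Euc m × Euc N) p.pt) -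
      p.val.1.comp (mfderiv 𝓘(ℝ, Euc m × Euc N) 𝓘(ℝ, Euc m) π p.pt)))
  let C : Euc m →L[ℝ] Euc m := a.dCSymm p.pt
  (ContinuousLinearMap.compL ℝ (Euc m) (Euc m) (Euc N)).flip C ∘L
    ContinuousLinearMap.compL ℝ (Euc m) (Euc m × Euc N) (Euc N) R

/-- The shift leaves the point of `E` unchanged and alters `σ` by a term linear in `A`, and the jet
coordinate is linear in `σ`. In a chart the fibre of `J¹E` is thus an affine space on which `A` acts
by translation. -/
theorem jetChart_shiftJet (a : AdaptedChart (Euc m) (Euc N) π) (p : J1 (Euc m) (Euc N) π)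
    (hp : p.pt ∈ a.e.source) (A : Euc m →L[ℝ] Euc m × Euc N) :
    jetChart π a (shiftJet π p A) = jetChart π a p + (0, 0, shiftLin a p A) := by
  have h1 := (jetModel (Euc m) (Euc N) π).chart_apply (f := p.val) hp
  have h2 := (jetModel (Euc m) (Euc N) π).chart_apply (f := (shiftJet π p A).val) hp
  have h1 : jetChart π a p = _ := h1
  have h2 : jetChart π a (shiftJet π p A) = _ := h2
  rw [h1, h2]
  refine Prod.ext (add_zero _).symm (Prod.ext (add_zero _).symm ?_)
  ext w i
  change (a.dE p.pt (p.val.1 (a.dCSymm p.pt w) + _)).2 i = (a.dE p.pt (p.val.1 (a.dCSymm p.pt w))).2 i + _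
  rw [map_add]
  rfl

theorem contDiffAt_jetChart_localExpr {L : J1 (Euc m) (Euc N) π → ℝ}
    (hL : ContMDiff 𝓘(ℝ, Euc m × JetFib m N) 𝓘(ℝ, ℝ) ∞ L) (a : AdaptedChart (Euc m) (Euc N) π)
    {u : Euc m × JetFib m N} (hu : u ∈ (jetChart π a).target) :
    ContDiffAt ℝ ∞ (fun u => L ((jetChart π a).symm u)) u :=
  ((hL _).comp u (contMDiffAt_symm_of_mem_maximalAtlas
    ((jetModel (Euc m) (Euc N) π).openChart_mem_maximalAtlas a) hu)).contDiffAt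

/-- Chain rule along the affine map `A ↦ u + (0, 0, shiftLin A)`: the intrinsic fibre derivative
becomes the partial derivative in the jet coordinates. -/
theorem fibreDeriv_eq {L : J1 (Euc m) (Euc N) π → ℝ}
    (hL : ContMDiff 𝓘(ℝ, Euc m × JetFib m N) 𝓘(ℝ, ℝ) ∞ L) (a : AdaptedChart (Euc m) (Euc N) π)
    {p : J1 (Euc m) (Euc N) π} (hp : p.pt ∈ a.e.source) (A : Euc m →L[ℝ] Euc m × Euc N) :
    fibreDeriv π L p A = fderiv ℝ (fun u => L ((jetChart π a).symm u)) (jetChart π a p)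
      (0, 0, shiftLin a p A) := by
  have hp' : p ∈ (jetChart π a).source := hp
  have h1 : (fun A => L (shiftJet π p A)) = fun A => (fun u => L ((jetChart π a).symm u))
      (jetChart π a p + (0, 0, shiftLin a p A)) := by
    funext A
    rw [← jetChart_shiftJet a p hp]
    exact congrArg L ((jetChart π a).left_inv (x := shiftJet π p A) hp).symm
  have h2 := (contDiffAt_jetChart_localExpr hL a ((jetChart π a).map_source hp')).differentiableAt
    (by simp)
  let Λ : (Euc m →L[ℝ] Euc m × Euc N) →L[ℝ] Euc m × JetFib m N :=
    (0 : (Euc m →L[ℝ] Euc m × Euc N) →L[ℝ] Euc m).prod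
      ((0 : (Euc m →L[ℝ] Euc m × Euc N) →L[ℝ] Euc N).prod (shiftLin a p))
  have h3 : HasFDerivAt (fun A => jetChart π a p + Λ A) Λ 0 := Λ.hasFDerivAt.const_add _
  have h4 : jetChart π a p + Λ 0 = jetChart π a p := by simp
  rw [← h4] at h2
  have h5 := (h2.hasFDerivAt.comp (0 : Euc m →L[ℝ] Euc m × Euc N) h3).fderiv
  change fderiv ℝ (fun A => L (shiftJet π p A)) 0 A = _
  rw [h1]
  refine (congrArg (fun T : (Euc m →L[ℝ] Euc m × Euc N) →L[ℝ] ℝ => T A) h5).trans ?_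
  rw [h4]
  rfl

/-- The local expression of the momentum map: `w ↦ ∑ α, ∂L/∂v (dx^α ⊗ (w₂ - v w₁)) • e_α`. -/
def localMomentum (L : J1 (Euc m) (Euc N) π → ℝ) (a : AdaptedChart (Euc m) (Euc N) π)
    (u : Euc m × JetFib m N) (w : Euc m × Euc N) : Euc m :=
  ∑ α : Fin m, fderiv ℝ (fun u => L ((jetChart π a).symm u)) u
    (0, 0, (EuclideanSpace.proj α : Euc m →L[ℝ] ℝ).smulRight (w.2 - u.2.2 w.1)) •
      EuclideanSpace.single α (1 : ℝ)

/-- `momentum` is defined by summing over the standard frame of the model, while the chart has its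
own frame. The proof shows that the sum is independent of the frame: its `α`-th component in the
chart is the fibre derivative along `dx^α ⊗ z`, and the vertical part of that tensor has jet
coordinates `e^α ⊗ (w₂ - v w₁)`. -/
theorem dC_momentum {L : J1 (Euc m) (Euc N) π → ℝ}
    (hL : ContMDiff 𝓘(ℝ, Euc m × JetFib m N) 𝓘(ℝ, ℝ) ∞ L) (a : AdaptedChart (Euc m) (Euc N) π)
    {p : J1 (Euc m) (Euc N) π} (hp : p.pt ∈ a.e.source) (w : Euc m × Euc N) :
    a.dC p.pt (momentum π L p (a.dESymm p.pt w)) = localMomentum L a (jetChart π a p) w := by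
  let C : Euc m →L[ℝ] Euc m := a.dC p.pt
  let z : Euc m × Euc N := a.dESymm p.pt w
  have h1 : momentum π L p (a.dESymm p.pt w) = ∑ β : Fin m, fibreDeriv π L p
      ((EuclideanSpace.proj β : Euc m →L[ℝ] ℝ).smulRight z) • EuclideanSpace.single β (1 : ℝ) := by
    change (∑ β : Fin m, ((fibreDeriv π L p).comp (ContinuousLinearMap.smulRightL ℝ (Euc m)
      (Euc m × Euc N) (EuclideanSpace.proj β))).smulRight (EuclideanSpace.single β (1 : ℝ))) z = _
    rw [sum_apply]
    rfl
  have h2 : ∀ α : Fin m, (C (momentum π L p (a.dESymm p.pt w))) α = fibreDeriv π L p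
      (((EuclideanSpace.proj α : Euc m →L[ℝ] ℝ).comp C).smulRight z) := by
    intro α
    -- The covector `dx^α` of the chart is expanded in the standard coframe; its coefficients are
    -- the entries of the Jacobian `C`.
    have h3 : (((EuclideanSpace.proj α : Euc m →L[ℝ] ℝ).comp C).smulRight z) =
        ∑ β : Fin m, (C (EuclideanSpace.single β (1 : ℝ))) α •
          (EuclideanSpace.proj β : Euc m →L[ℝ] ℝ).smulRight z := by
      ext1 x
      have h4 : x = ∑ β : Fin m, x β • EuclideanSpace.single β (1 : ℝ) := by
        ext i
        simp [Finset.sum_apply, Pi.single_apply]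
      have h5 : (C x) α = ∑ β : Fin m, x β * (C (EuclideanSpace.single β (1 : ℝ))) α := by
        conv_lhs => rw [h4, map_sum]
        simp
      change (C x) α • z = _
      rw [h5, Finset.sum_smul, sum_apply]
      refine Finset.sum_congr rfl fun β _ => ?_
      change _ = (C (EuclideanSpace.single β (1 : ℝ))) α • (x β • z)
      rw [smul_smul, mul_comm]
    rw [h1, h3, map_sum, map_sum]
    simp [mul_comm]
  ext α
  refine (h2 α).trans ?_
  rw [fibreDeriv_eq hL a hp]
  -- Since `T_yπ z` corresponds to `w₁`, subtracting `σ (T_yπ z)` leaves the fibre component `w₂ - v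
  -- w₁`.
  have h6 : shiftLin a p (((EuclideanSpace.proj α : Euc m →L[ℝ] ℝ).comp C).smulRight z) =
      (EuclideanSpace.proj α : Euc m →L[ℝ] ℝ).smulRight (w.2 - (jetChart π a p).2.2 w.1) := by
    have hv : (jetChart π a p).2.2 w.1 = (a.dE p.pt (p.val.1 (a.dCSymm p.pt w.1))).2 := by
      have h1 := (jetModel (Euc m) (Euc N) π).chart_apply (f := p.val) hp
      have h1 : jetChart π a p = _ := h1
      rw [h1]
      rfl
    ext1 x
    have h7 : C (a.dCSymm p.pt x) = x := a.dC_dCSymm hp x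
    change (a.dE p.pt ((C (a.dCSymm p.pt x)) α • a.dESymm p.pt w - p.val.1
      (mfderiv 𝓘(ℝ, Euc m × Euc N) 𝓘(ℝ, Euc m) π p.pt
        ((C (a.dCSymm p.pt x)) α • a.dESymm p.pt w)))).2 = x α • (w.2 - _)
    rw [h7, hv, map_smul, map_smul, ← smul_sub, map_smul, map_sub, a.dE_dESymm hp,
      a.mfderiv_dESymm hp]
    rfl
  rw [h6]
  simp [localMomentum, Finset.sum_apply, Pi.single_apply]

/-- The local expression of the extended Legendre map. -/
theorem coord_legendre {L : J1 (Euc m) (Euc N) π → ℝ}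
    (hL : ContMDiff 𝓘(ℝ, Euc m × JetFib m N) 𝓘(ℝ, ℝ) ∞ L) (vol : DForm (Euc m) M m)
    (a : AdaptedChart (Euc m) (Euc N) π) {p : J1 (Euc m) (Euc N) π} (hp : p.pt ∈ a.e.source)
    (w : Fin m → Euc m × Euc N) :
    ((momModel (Euc m) (Euc N) m π).coord a p.pt hp (legendre π vol L p).val).1 w =
      (∑ i, vol.localExpr a.c (jetChart π a p).1
        (Function.update (fun n => (w n).1) i (localMomentum L a (jetChart π a p) (w i)))) +
      L p * vol.localExpr a.c (jetChart π a p).1 (fun n => (w n).1) := by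
  have h0 : (jetChart π a p).1 = a.c (π p.pt) := a.fst_eq p.pt hp
  have key : ∀ x, x = π p.pt → ∀ v : Fin m → Euc m, vol x v = vol (π p.pt) v := by
    rintro _ rfl _
    rfl
  have h1 : ∀ v : Fin m → Euc m, vol.localExpr a.c (jetChart π a p).1 v =
      vol (π p.pt) fun i => a.dCSymm p.pt (v i) := by
    intro v
    rw [h0]
    exact key _ (a.c.left_inv (a.maps _ hp)) _
  have h2 : ∀ z, mfderiv 𝓘(ℝ, Euc m × Euc N) 𝓘(ℝ, Euc m) π p.pt (a.dESymm p.pt z) =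
    a.dCSymm p.pt z.1 := a.mfderiv_dESymm hp
  have h3 : ∀ z, momentum π L p (a.dESymm p.pt z) =
      a.dCSymm p.pt (localMomentum L a (jetChart π a p) z) := by
    intro z
    rw [← dC_momentum hL a hp, a.dCSymm_dC hp]
  simp only [h1]
  change insertDer (vol (π p.pt)) _ (momentum π L p) (fun i => a.dESymm p.pt (w i)) +
    L p * vol (π p.pt) (fun i => mfderiv 𝓘(ℝ, Euc m × Euc N) 𝓘(ℝ, Euc m) π p.pt
      (a.dESymm p.pt (w i))) = _
  rw [insertDer_apply]
  simp only [h2, h3]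
  congr 1
  refine Finset.sum_congr rfl fun i _ => congrArg _ ?_
  funext n
  by_cases hn : n = i
  · subst hn
    simp
  · simp [hn]

variable (π)

/-- By `coord_legendre` the local expression is polynomial in the volume form, the Lagrangian, its
first partial derivatives and the jet coordinates, evaluated on constant vectors. -/
theorem contMDiff_legendre {vol : DForm (Euc m) M m} (hvol : vol.Smooth)
    {L : J1 (Euc m) (Euc N) π → ℝ} (hL : ContMDiff 𝓘(ℝ, Euc m × JetFib m N) 𝓘(ℝ, ℝ) ∞ L) :
    ContMDiff 𝓘(ℝ, Euc m × JetFib m N) 𝓘(ℝ, Euc m × MomFib m N) ∞ (legendre π vol L) := by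
  refine FibModel.contMDiff_map (jetModel (Euc m) (Euc N) π) (momModel (Euc m) (Euc N) m π)
    (f := fun b => b) contMDiff_id (fun b σ => (legendre π vol L ⟨b, σ⟩).val) ?_
  intro b σ
  obtain ⟨a, ha⟩ := Fibered.exists_chart (Euc m) (Euc N) (τ := π) b
  -- The fibre coordinate map is taken to be the Legendre map read in the charts, so its defining
  -- property holds by inversion of a chart; the explicit formula is needed only for smoothness,
  -- where it holds near the point.
  refine ⟨a, a, ha, ha, fun z => (momChart π a (legendre π vol L
    ((jetChart π a).symm (z.1.1, z.1.2, z.2)))).2.2, ?_, ?_⟩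
  · refine contDiffAt_momSpace fun w => ?_
    set z₀ : (Euc m × Euc N) × (Euc m →L[ℝ] Euc N) :=
      (a.e b, (jetModel (Euc m) (Euc N) π).coord a b ha σ) with hz₀
    let ψ : (Euc m × Euc N) × (Euc m →L[ℝ] Euc N) → Euc m × JetFib m N :=
      fun z => (z.1.1, z.1.2, z.2)
    have hψ : ContDiffAt ℝ ∞ ψ z₀ := by fun_prop
    have hψ0 : ψ z₀ ∈ (jetChart π a).target := a.e.map_source ha
    let g : Euc m × JetFib m N → ℝ := fun u =>
      (∑ i, vol.localExpr a.c u.1 (Function.update (fun n => (w n).1) i (localMomentum L a u (w i)))) +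
      L ((jetChart π a).symm u) * vol.localExpr a.c u.1 (fun n => (w n).1)
    have hvol' : ContDiffAt ℝ ∞ (fun u : Euc m × JetFib m N => vol.localExpr a.c u.1) (ψ z₀) := by
      have h1 : (ψ z₀).1 ∈ a.c.target := by
        change (a.e b).1 ∈ _
        rw [a.fst_eq b ha]
        exact a.c.map_source (a.maps b ha)
      exact ContDiffAt.comp (g := vol.localExpr a.c) (f := fun u : Euc m × JetFib m N => u.1) (ψ z₀)
        (hvol.contDiffAt_localExpr a.hc h1) (by fun_prop)
    have hL' := contDiffAt_jetChart_localExpr hL a hψ0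
    have hdL : ContDiffAt ℝ ∞ (fderiv ℝ (fun u => L ((jetChart π a).symm u))) (ψ z₀) :=
      hL'.fderiv_right (by simp)
    have hP : ∀ v, ContDiffAt ℝ ∞ (fun u => localMomentum L a u v) (ψ z₀) := by
      intro v
      refine ContDiffAt.sum fun α _ => ContDiffAt.smul (hdL.clm_apply ?_) contDiffAt_const
      refine contDiffAt_const.prodMk (contDiffAt_const.prodMk ?_)
      have h2 : ContDiffAt ℝ ∞ (fun u : Euc m × JetFib m N => v.2 - u.2.2 v.1) (ψ z₀) := by
        fun_prop
      exact ((ContinuousLinearMap.smulRightL ℝ (Euc m) (Euc N)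
        (EuclideanSpace.proj α : Euc m →L[ℝ] ℝ)).contDiff.contDiffAt).comp (ψ z₀) h2
    have hg : ContDiffAt ℝ ∞ g (ψ z₀) := by
      refine ContDiffAt.add (ContDiffAt.sum fun i _ => ?_) (hL'.mul ?_)
      · refine contDiffAt_alternating_apply (w := fun n u => Function.update (fun n => (w n).1) i
          (localMomentum L a u (w i)) n) hvol' fun n => ?_
        by_cases hn : n = i
        · subst hn
          simpa using hP (w n)
        · simpa [hn] using contDiffAt_const
      · exact contDiffAt_alternating_apply (w := fun n _ => (w n).1) hvol' fun n => contDiffAt_const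
    refine (ContDiffAt.comp (g := g) (f := ψ) z₀ hg hψ).congr_of_eventuallyEq ?_
    filter_upwards [hψ.continuousAt.eventually ((jetChart π a).open_target.mem_nhds hψ0)] with z hz
    have hpt : ((jetChart π a).symm (ψ z)).pt ∈ a.e.source := (jetChart π a).map_target hz
    have h3 := coord_legendre hL vol a hpt w
    rw [(jetChart π a).right_inv hz] at h3
    refine Eq.trans ?_ h3
    have h4 := (momModel (Euc m) (Euc N) m π).chart_apply
      (f := (legendre π vol L ((jetChart π a).symm (ψ z))).val) hpt
    exact congrArg (fun y : Euc m × MomFib m N => y.2.2.1 w) h4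
  · intro b₁ h₁ h₁' σ₁
    have h1 := (jetModel (Euc m) (Euc N) π).chart_apply (f := σ₁) h₁
    have h1 : jetChart π a ⟨b₁, σ₁⟩ = ((a.e b₁).1, (a.e b₁).2,
      (jetModel (Euc m) (Euc N) π).coord a b₁ h₁ σ₁) := h1
    have h2 : (jetChart π a).symm ((a.e b₁).1, (a.e b₁).2,
        (jetModel (Euc m) (Euc N) π).coord a b₁ h₁ σ₁) = ⟨b₁, σ₁⟩ := by
      rw [← h1]
      exact (jetChart π a).left_inv (x := (⟨b₁, σ₁⟩ : J1 (Euc m) (Euc N) π)) h₁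
    change _ = (momChart π a (legendre π vol L ((jetChart π a).symm ((a.e b₁).1, (a.e b₁).2,
        (jetModel (Euc m) (Euc N) π).coord a b₁ h₁ σ₁)))).2.2
    rw [h2]
    have h4 := (momModel (Euc m) (Euc N) m π).chart_apply
      (f := (legendre π vol L ⟨b₁, σ₁⟩).val) h₁'
    exact (congrArg (fun y : Euc m × MomFib m N => y.2.2) h4).symm

end Lagrangian

/-! ### Prolongation of fibred maps to first jets. -/

section Prolongation
variable {X G G' : Type*} [NormedAddCommGroup X] [NormedSpace ℝ X] [NormedAddCommGroup G]
  [NormedSpace ℝ G] [NormedAddCommGroup G'] [NormedSpace ℝ G']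
  {B B' M : Type*} [TopologicalSpace B] [ChartedSpace (X × G) B] [IsManifold 𝓘(ℝ, X × G) ∞ B]
  [TopologicalSpace B'] [ChartedSpace (X × G') B'] [IsManifold 𝓘(ℝ, X × G') ∞ B']
  [TopologicalSpace M] [ChartedSpace X M] [IsManifold 𝓘(ℝ, X) ∞ M]

theorem Fibered.contMDiff (τ : B → M) [Fibered X G τ] : ContMDiff 𝓘(ℝ, X × G) 𝓘(ℝ, X) ∞ τ := by
  intro b
  obtain ⟨a, ha⟩ := Fibered.exists_chart X G (τ := τ) b
  exact a.contMDiffAt ha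

variable (τ' : B' → M) [Fibered X G' τ'] {f : B → B'}

theorem mfderiv_base_comp (hf : ContMDiff 𝓘(ℝ, X × G) 𝓘(ℝ, X × G') ∞ f) (b : B) (v : TangentSpace 𝓘(ℝ, X × G) b) :
    mfderiv 𝓘(ℝ, X × G) 𝓘(ℝ, X) (fun b => τ' (f b)) b v =
      mfderiv 𝓘(ℝ, X × G') 𝓘(ℝ, X) τ' (f b) (mfderiv 𝓘(ℝ, X × G) 𝓘(ℝ, X × G') f b v) :=
  mfderiv_comp_apply b ((Fibered.contMDiff τ' _).mdifferentiableAt (by simp))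
    ((hf b).mdifferentiableAt (by simp)) v

/-- The action on 1-jets of the prolongation of a fibred map over the identity. -/
def prolong (hf : ContMDiff 𝓘(ℝ, X × G) 𝓘(ℝ, X × G') ∞ f) (b : B) (σ : JetAt X G (fun b => τ' (f b)) b) : JetAt X G' τ' (f b) :=
  ⟨(mfderiv 𝓘(ℝ, X × G) 𝓘(ℝ, X × G') f b).comp σ.1, fun v =>
    (mfderiv_base_comp τ' hf b (σ.1 v)).symm.trans (σ.2 v)⟩

variable [Fibered X G (fun b => τ' (f b))]

/-- The prolongation of a smooth fibred map over the identity is smooth. -/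
theorem contMDiff_prolong (hf : ContMDiff 𝓘(ℝ, X × G) 𝓘(ℝ, X × G') ∞ f) :
    ContMDiff 𝓘(ℝ, X × (G × (X →L[ℝ] G))) 𝓘(ℝ, X × (G' × (X →L[ℝ] G'))) ∞
    (fun p : J1 X G (fun b => τ' (f b)) => (⟨f p.pt, prolong τ' hf p.pt p.val⟩ : J1 X G' τ')) := by
  refine FibModel.contMDiff_map (jetModel X G (fun b => τ' (f b))) (jetModel X G' τ') hf
    (prolong τ' hf) ?_
  intro b σ
  obtain ⟨a, ha⟩ := Fibered.exists_chart X G (τ := fun b => τ' (f b)) b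
  obtain ⟨a', ha'⟩ := Fibered.exists_chart X G' (τ := τ') (f b)
  -- In coordinates the tangent map `(id, v)` of a section is composed with the derivative of `f`.
  -- The adapted charts of source and target may use different charts of `M`, hence the extra
  -- transition from `a'.c` to `a.c` on the right.
  refine ⟨a, a', ha, ha', fun z => (ContinuousLinearMap.snd ℝ X G').comp
      ((fderiv ℝ (fun u => a'.e (f (a.e.symm u))) z.1).comp
        (((ContinuousLinearMap.id ℝ X).prod z.2).comp
          (fderiv ℝ (a.c ∘ a'.c.symm) (a'.e (f (a.e.symm z.1))).1))), ?_, ?_⟩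
  · set z₀ : (X × G) × (X →L[ℝ] G) := (a.e b, (jetModel X G (fun b => τ' (f b))).coord a b ha σ)
    have hloc : ContDiffAt ℝ ∞ (fun u => a'.e (f (a.e.symm u))) z₀.1 :=
      contDiffAt_localExpr a.he a'.he ha ha' (hf b)
    have h1 : ContDiffAt ℝ ∞ (fun z : (X × G) × (X →L[ℝ] G) =>
        fderiv ℝ (fun u => a'.e (f (a.e.symm u))) z.1) z₀ :=
      ContDiffAt.comp (g := fderiv ℝ (fun u => a'.e (f (a.e.symm u)))) (f := Prod.fst) z₀
        (hloc.fderiv_right (by simp)) contDiffAt_fst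
    have h2 : ContDiffAt ℝ ∞ (fun z : (X × G) × (X →L[ℝ] G) => (a'.e (f (a.e.symm z.1))).1) z₀ :=
      (ContDiffAt.comp (g := fun u => a'.e (f (a.e.symm u))) (f := Prod.fst) z₀ hloc
        contDiffAt_fst).fst
    have h3 : ContDiffAt ℝ ∞ (fun z : (X × G) × (X →L[ℝ] G) =>
        fderiv ℝ (a.c ∘ a'.c.symm) (a'.e (f (a.e.symm z.1))).1) z₀ := by
      have h4 : (a'.e (f (a.e.symm z₀.1))).1 = a'.c (τ' (f b)) := by
        change (a'.e (f (a.e.symm (a.e b)))).1 = _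
        rw [a.e.left_inv ha, a'.fst_eq _ ha']
      have h5 : (a'.e (f (a.e.symm z₀.1))).1 ∈ a'.c.target ∩ a'.c.symm ⁻¹' a.c.source := by
        rw [h4]
        refine ⟨a'.c.map_source (a'.maps _ ha'), ?_⟩
        rw [mem_preimage, a'.c.left_inv (a'.maps _ ha')]
        exact a.maps _ ha
      exact ContDiffAt.comp (g := fderiv ℝ (a.c ∘ a'.c.symm))
        (f := fun z : (X × G) × (X →L[ℝ] G) => (a'.e (f (a.e.symm z.1))).1) z₀
        ((contDiffOn_fderiv_transition a'.hc a.hc).contDiffAt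
          ((a'.c.isOpen_inter_preimage_symm a.c.open_source).mem_nhds h5)) h2
    have hv : ContDiff ℝ ∞ (fun v : X →L[ℝ] G => (ContinuousLinearMap.id ℝ X).prod v) := by
      have h : (fun v : X →L[ℝ] G => (ContinuousLinearMap.id ℝ X).prod v) = fun v =>
          (ContinuousLinearMap.inl ℝ X G) + (ContinuousLinearMap.inr ℝ X G).comp v := by
        ext v w <;> simp
      rw [h]
      exact contDiff_const.add (contDiff_const.clm_comp contDiff_id)
    exact contDiffAt_const.clm_comp (h1.clm_comp
      ((hv.contDiffAt.comp z₀ contDiffAt_snd).clm_comp h3))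
  · intro b h h' σ
    ext w
    have h1 := a'.c.left_inv (a'.maps _ h')
    have h2 : a.dC b (a'.dCSymm (f b) w) = fderiv ℝ (a.c ∘ a'.c.symm) (a'.c (τ' (f b))) w :=
      (fderiv_transition a'.hc a.hc (a'.maps _ h') (a.maps b h) w).symm
    have h3 := a.fst_dE h (σ.1 (a'.dCSymm (f b) w))
    rw [σ.2] at h3
    have h4 : (a.dC b (a'.dCSymm (f b) w), (a.dE b (σ.1 (a'.dCSymm (f b) w))).2) =
      a.dE b (σ.1 (a'.dCSymm (f b) w)) := Prod.ext h3.symm rfl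
    have h5 := fderiv_localExpr a.he a'.he h h' ((hf b).mdifferentiableAt (by simp))
      (a.dE b (σ.1 (a'.dCSymm (f b) w)))
    have h6 : mfderiv 𝓘(ℝ, X × G) 𝓘(ℝ, X × G) a.e.symm (a.e b)
      (a.dE b (σ.1 (a'.dCSymm (f b) w))) = σ.1 (a'.dCSymm (f b) w) := a.dESymm_dE h _
    rw [h6] at h5
    change (a'.dE (f b) (mfderiv 𝓘(ℝ, X × G) 𝓘(ℝ, X × G') f b (σ.1 (a'.dCSymm (f b) w)))).2 =
      (fderiv ℝ (fun u => a'.e (f (a.e.symm u))) (a.e b)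
        (fderiv ℝ (a.c ∘ a'.c.symm) (a'.e (f (a.e.symm (a.e b)))).1 w, (a.dE b (σ.1 (a.dCSymm b
          (fderiv ℝ (a.c ∘ a'.c.symm) (a'.e (f (a.e.symm (a.e b)))).1 w)))).2)).2
    rw [a.e.left_inv h, a'.fst_eq _ h', ← h2, a.dCSymm_dC h, h4, h5]
    rfl

end Prolongation

/-! ### Smooth vector fields along maps. -/

section TangentVectors
variable {V A V' A' D S : Type*} [NormedAddCommGroup V] [NormedSpace ℝ V]
  [TopologicalSpace A] [ChartedSpace V A] [IsManifold 𝓘(ℝ, V) ∞ A]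
  [NormedAddCommGroup V'] [NormedSpace ℝ V']
  [TopologicalSpace A'] [ChartedSpace V' A'] [IsManifold 𝓘(ℝ, V') ∞ A']
  [NormedAddCommGroup D] [NormedSpace ℝ D] [TopologicalSpace S] [ChartedSpace D S]
  {Φ : S → A} {Y : ∀ s, TangentSpace 𝓘(ℝ, V) (Φ s)} {U : Set S}

theorem contMDiffOn_mfderiv_apply {f : A → A'} (hf : ContMDiff 𝓘(ℝ, V) 𝓘(ℝ, V') ∞ f)
    (hY : ContMDiffOn 𝓘(ℝ, D) 𝓘(ℝ, V).tangent ∞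
      (fun s => (⟨Φ s, Y s⟩ : TangentBundle 𝓘(ℝ, V) A)) U) :
    ContMDiffOn 𝓘(ℝ, D) 𝓘(ℝ, V').tangent ∞
      (fun s => (⟨f (Φ s), mfderiv 𝓘(ℝ, V) 𝓘(ℝ, V') f (Φ s) (Y s)⟩ : TangentBundle 𝓘(ℝ, V') A')) U :=
  (hf.contMDiff_tangentMap (m := ∞) (by simp)).comp_contMDiffOn hY

/-- Trivialisations of the tangent bundle are linear on fibres, so rescaling multiplies the fibre
component by `g` and leaves the base component alone. -/
theorem contMDiffOn_smul_tangent {g : S → ℝ} (hg : ContMDiff 𝓘(ℝ, D) 𝓘(ℝ, ℝ) ∞ g)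
    (hY : ContMDiffOn 𝓘(ℝ, D) 𝓘(ℝ, V).tangent ∞
      (fun s => (⟨Φ s, Y s⟩ : TangentBundle 𝓘(ℝ, V) A)) U) :
    ContMDiffOn 𝓘(ℝ, D) 𝓘(ℝ, V).tangent ∞
      (fun s => (⟨Φ s, g s • Y s⟩ : TangentBundle 𝓘(ℝ, V) A)) U := by
  intro s hs
  have h := hY s hs
  have h1 := Bundle.contMDiffWithinAt_totalSpace.1 h
  refine Bundle.contMDiffWithinAt_totalSpace.2 ⟨h1.1, ?_⟩
  refine ((hg s).contMDiffWithinAt.smul h1.2).congr_of_eventuallyEq ?_ ?_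
  · have hb := h1.1.continuousWithinAt.eventually
      ((trivializationAt V (TangentSpace 𝓘(ℝ, V)) (Φ s)).open_baseSet.mem_nhds
        (FiberBundle.mem_baseSet_trivializationAt V (TangentSpace 𝓘(ℝ, V)) (Φ s)))
    filter_upwards [hb] with x hx
    exact ((trivializationAt V (TangentSpace 𝓘(ℝ, V)) (Φ s)).linear ℝ hx).map_smul (g x) (Y x)
  · exact ((trivializationAt V (TangentSpace 𝓘(ℝ, V)) (Φ s)).linear ℝ
      (FiberBundle.mem_baseSet_trivializationAt V (TangentSpace 𝓘(ℝ, V)) (Φ s))).map_smul (g s) (Y s)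

end TangentVectors

/-! ### Naturality of pairings and contractions under linear maps. -/

section MultiVectors
variable {T T' : Type*} [AddCommGroup T] [Module ℝ T] [AddCommGroup T'] [Module ℝ T'] {k : ℕ}

theorem pairing_smul (β : T [⋀^Fin k]→ₗ[ℝ] ℝ) (c : ℝ) (x : ⋀[ℝ]^k T) :
    pairing β (c • x) = c * pairing β x := by
  simp [pairing]

theorem pairing_zero (β : T [⋀^Fin k]→ₗ[ℝ] ℝ) : pairing β 0 = 0 := by
  simp [pairing]

/-- Both sides are linear in the multivector, so it is enough to compare them on decomposable ones.
-/
theorem pairing_map (f : T →ₗ[ℝ] T') (β : T' [⋀^Fin k]→ₗ[ℝ] ℝ) (x : ⋀[ℝ]^k T) :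
    pairing β (exteriorPower.map k f x) = pairing (β.compLinearMap f) x := by
  have h : (exteriorPower.alternatingMapLinearEquiv β).comp (exteriorPower.map k f) =
      exteriorPower.alternatingMapLinearEquiv (β.compLinearMap f) := by
    apply exteriorPower.linearMap_ext
    ext v
    simp [Function.comp_def]
  exact congrArg (fun l => l x) h

variable [TopologicalSpace T] [TopologicalSpace T']

theorem mvContr_smul (c : ℝ) (x : ⋀[ℝ]^k T) (β : T [⋀^Fin (k + 1)]→L[ℝ] ℝ) (w : T) :
    mvContr (c • x) β w = c * mvContr x β w := by
  rw [mvContr, mvContr, pairing_smul]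
  ring

/-- Inserting `f w` into `β` and then pulling back by `f` is inserting `w` into the pull-back of
`β`; the sign depends only on `k`. -/
theorem mvContr_map (f : T →L[ℝ] T') (x : ⋀[ℝ]^k T) (β : T' [⋀^Fin (k + 1)]→L[ℝ] ℝ) (w : T) :
    mvContr (exteriorPower.map k f.toLinearMap x) β (f w) =
      mvContr x (β.compContinuousLinearMap f) w := by
  rw [mvContr, mvContr, pairing_map]
  exact congrArg (fun γ => (-1) ^ k * pairing γ x)
    (AlternatingMap.curryLeft_compLinearMap f.toLinearMap β.toAlternatingMap w).symm

theorem pairing_compLinearMap_map {H : Type*} [AddCommGroup H] [Module ℝ H] [TopologicalSpace H]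
    {f : T →L[ℝ] T'} {t : T →L[ℝ] H} {t' : T' →L[ℝ] H} (h : t'.comp f = t) (β : H [⋀^Fin k]→ₗ[ℝ] ℝ)
    (x : ⋀[ℝ]^k T) : pairing (β.compLinearMap t'.toLinearMap) (exteriorPower.map k f.toLinearMap x) =
      pairing (β.compLinearMap t.toLinearMap) x := by
  subst h
  rw [pairing_map]
  rfl

theorem map_map_of_comp_eq {H : Type*} [AddCommGroup H] [Module ℝ H] [TopologicalSpace H]
    {f : T →L[ℝ] T'} {t : T →L[ℝ] H} {t' : T' →L[ℝ] H} (h : t'.comp f = t) (x : ⋀[ℝ]^k T) :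
    exteriorPower.map k t'.toLinearMap (exteriorPower.map k f.toLinearMap x) =
      exteriorPower.map k t.toLinearMap x := by
  subst h
  exact (congrArg (fun T => T x) (exteriorPower.map_comp (n := k) f.toLinearMap t'.toLinearMap)).symm

/-- Carries semi-holonomy across `TF`: with `t' = Tκ` and `t = Tπ¹`, both conditions concern the
same line in `ΛᵐTE`. -/
theorem span_map_of_comp_eq {H : Type*} [AddCommGroup H] [Module ℝ H] [TopologicalSpace H]
    {f : T →L[ℝ] T'} {t : T →L[ℝ] H} {t' : T' →L[ℝ] H} (h : t'.comp f = t) {x : ⋀[ℝ]^k T}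
    {y : ⋀[ℝ]^k T'} (hxy : exteriorPower.map k f.toLinearMap x = y) :
    Submodule.span ℝ {exteriorPower.map k t'.toLinearMap y} =
      Submodule.span ℝ {exteriorPower.map k t.toLinearMap x} := by
  rw [← hxy, map_map_of_comp_eq h]

theorem map_smul_of_eq {f : T →L[ℝ] T'} {x : ⋀[ℝ]^k T} {y : ⋀[ℝ]^k T'}
    (hxy : exteriorPower.map k f.toLinearMap x = y) (c : ℝ) :
    exteriorPower.map k f.toLinearMap (c • x) = c • y := by
  rw [map_smul, hxy]

theorem mvContr_of_eq_pullback {f : T →L[ℝ] T'} {γ : T [⋀^Fin (k + 1)]→L[ℝ] ℝ}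
    {β : T' [⋀^Fin (k + 1)]→L[ℝ] ℝ} (h : γ = β.compContinuousLinearMap f) (x : ⋀[ℝ]^k T) (w : T) :
    mvContr x γ w = mvContr (exteriorPower.map k f.toLinearMap x) β (f w) := by
  rw [h, mvContr_map]

theorem jetContr_comp {H : Type*} [AddCommGroup H] [Module ℝ H] [TopologicalSpace H]
    (f : T →L[ℝ] T') (σ : H →L[ℝ] T) (β : T' [⋀^Fin (k + 1)]→L[ℝ] ℝ) (Z : Fin k → H) (w : T) :
    jetContr (f.comp σ) β Z (f w) = jetContr σ (β.compContinuousLinearMap f) Z w := by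
  change β _ = β _
  congr 1
  funext i
  refine Fin.lastCases ?_ (fun i => ?_) i <;> simp

/-- In the `i`-th summand the slot `i` holds `f (C (t (f vᵢ)))` and every other slot holds `f vₙ`,
so `f` can be moved from all slots into the form. -/
theorem connContr_comp {H : Type*} [AddCommGroup H] [Module ℝ H] [TopologicalSpace H]
    (f : T →L[ℝ] T') (C : H →L[ℝ] T) (t : T' →L[ℝ] H) (β : T' [⋀^Fin k]→L[ℝ] ℝ) :
    (connContr (f.comp C) t β).compContinuousLinearMap f =
      connContr C (t.comp f) (β.compContinuousLinearMap f) := by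
  ext v
  change insertDer β _ _ (fun i => f (v i)) = insertDer (β.compContinuousLinearMap f) _ _ v
  rw [insertDer_apply, insertDer_apply]
  refine Finset.sum_congr rfl fun i _ => ?_
  change β _ = β _
  congr 1
  funext n
  by_cases hn : n = i
  · subst hn
    simp
  · simp [hn]

end MultiVectors

/-! ### Decomposable multivector fields and their classes. -/

section MultiVF
variable {X G X' G' D : Type*} [NormedAddCommGroup X] [NormedSpace ℝ X] [NormedAddCommGroup G]
  [NormedSpace ℝ G] [NormedAddCommGroup X'] [NormedSpace ℝ X'] [NormedAddCommGroup G']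
  [NormedSpace ℝ G'] [NormedAddCommGroup D] [NormedSpace ℝ D]
  {B B' S : Type*} [TopologicalSpace B] [ChartedSpace (X × G) B] [IsManifold 𝓘(ℝ, X × G) ∞ B]
  [TopologicalSpace B'] [ChartedSpace (X' × G') B'] [IsManifold 𝓘(ℝ, X' × G') ∞ B']
  [TopologicalSpace S] [ChartedSpace D S] {m : ℕ} {Φ : S → B}
  {K K' : ∀ s, ⋀[ℝ]^m (TangentSpace 𝓘(ℝ, X × G) (Φ s))}

/-- The scalar is absorbed into one of the factors, which requires a factor: for `m = 0` the only
wedge product is `1`. -/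
theorem IsMultiVF.smul (hm : 0 < m) (hK : IsMultiVF X G D m Φ K) {g : S → ℝ}
    (hg : ContMDiff 𝓘(ℝ, D) 𝓘(ℝ, ℝ) ∞ g) (hg0 : ∀ s, g s ≠ 0) :
    IsMultiVF X G D m Φ (fun s => g s • K s) where
  locallyDecomposable s₀ := by
    obtain ⟨U, hU, hs, Y, hY, hKY⟩ := hK.locallyDecomposable s₀
    let i₀ : Fin m := ⟨0, hm⟩
    refine ⟨U, hU, hs, fun i s => if i = i₀ then g s • Y i s else Y i s, fun i => ?_, fun s hs => ?_⟩
    · by_cases hi : i = i₀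
      · simpa [hi] using contMDiffOn_smul_tangent hg (hY i₀)
      · simpa [hi] using hY i
    · have h1 : (fun i => if i = i₀ then g s • Y i s else Y i s) =
          Function.update (fun i => Y i s) i₀ (g s • Y i₀ s) := by
        funext i
        by_cases hi : i = i₀
        · subst hi
          simp
        · simp [hi]
      rw [h1, AlternatingMap.map_update_smul, Function.update_eq_self, hKY s hs]
  ne_zero s := smul_ne_zero (hg0 s) (hK.ne_zero s)

theorem IsMultiVF.map (hK : IsMultiVF X G D m Φ K) {f : B → B'}
    (hf : ContMDiff 𝓘(ℝ, X × G) 𝓘(ℝ, X' × G') ∞ f)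
    (h0 : ∀ s, exteriorPower.map m (mfderiv 𝓘(ℝ, X × G) 𝓘(ℝ, X' × G') f (Φ s)).toLinearMap (K s) ≠ 0) :
    IsMultiVF X' G' D m (fun s => f (Φ s)) (fun s =>
      exteriorPower.map m (mfderiv 𝓘(ℝ, X × G) 𝓘(ℝ, X' × G') f (Φ s)).toLinearMap (K s)) where
  locallyDecomposable s₀ := by
    obtain ⟨U, hU, hs, Y, hY, hKY⟩ := hK.locallyDecomposable s₀
    refine ⟨U, hU, hs, fun i s => mfderiv 𝓘(ℝ, X × G) 𝓘(ℝ, X' × G') f (Φ s) (Y i s),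
      fun i => contMDiffOn_mfderiv_apply hf (hY i), fun s hs => ?_⟩
    rw [hKY s hs, exteriorPower.map_apply_ιMulti]
    rfl
  ne_zero := h0

theorem self_mem_mvClass : K ∈ mvClass X G D m Φ K :=
  ⟨fun _ => 1, contMDiff_const, fun _ => one_ne_zero, fun s => (one_smul ℝ (K s)).symm⟩

theorem contMDiff_inv_of_ne_zero {g : S → ℝ} (hg : ContMDiff 𝓘(ℝ, D) 𝓘(ℝ, ℝ) ∞ g)
    (hg0 : ∀ s, g s ≠ 0) : ContMDiff 𝓘(ℝ, D) 𝓘(ℝ, ℝ) ∞ (fun s => (g s)⁻¹) := fun s =>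
  ((contDiffAt_inv ℝ (hg0 s)).contMDiffAt).comp s (hg s)

theorem mem_mvClass_symm (h : K' ∈ mvClass X G D m Φ K) : K ∈ mvClass X G D m Φ K' := by
  obtain ⟨g, hg, hg0, hgK⟩ := h
  refine ⟨fun s => (g s)⁻¹, contMDiff_inv_of_ne_zero hg hg0, fun s => inv_ne_zero (hg0 s), fun s => ?_⟩
  rw [hgK, smul_smul, inv_mul_cancel₀ (hg0 s), one_smul]

theorem mem_mvClass_trans {K'' : ∀ s, ⋀[ℝ]^m (TangentSpace 𝓘(ℝ, X × G) (Φ s))}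
    (h : K' ∈ mvClass X G D m Φ K) (h' : K'' ∈ mvClass X G D m Φ K') : K'' ∈ mvClass X G D m Φ K := by
  obtain ⟨g, hg, hg0, hgK⟩ := h
  obtain ⟨g', hg', hg0', hgK'⟩ := h'
  refine ⟨fun s => g' s * g s, hg'.mul hg, fun s => mul_ne_zero (hg0' s) (hg0 s), fun s => ?_⟩
  rw [hgK', hgK, smul_smul]

/-- Non-vanishing smooth functions form a group under multiplication, so classes are orbits and a
class is determined by any member. This yields uniqueness of classes. -/
theorem mvClass_eq_of_mem (h : K' ∈ mvClass X G D m Φ K) :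
    mvClass X G D m Φ K' = mvClass X G D m Φ K :=
  Subset.antisymm (fun _ h' => mem_mvClass_trans h h')
    fun _ h' => mem_mvClass_trans (mem_mvClass_symm h) h'

end MultiVF

/-! ### The Poincaré–Cartan forms as pull-backs by the extended Legendre map. -/

section Operators
variable {m N : ℕ} {M E : Type*} [TopologicalSpace M] [ChartedSpace (Euc m) M]
  [IsManifold 𝓘(ℝ, Euc m) ∞ M] [TopologicalSpace E]
  [ChartedSpace (Euc m × Euc N) E]
  [IsManifold 𝓘(ℝ, Euc m × Euc N) ∞ E]
  {D S : Type*} [NormedAddCommGroup D] [NormedSpace ℝ D] [TopologicalSpace S] [ChartedSpace D S]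
  {π : E → M} [Fibered (Euc m) (Euc N) π] {vol : DForm (Euc m) M m}
  {L : J1 (Euc m) (Euc N) π → ℝ}

theorem dMomBase_eq (q : Mom (Euc m) (Euc N) m π) (v) :
    dMomBase m N π q v = mfderiv 𝓘(ℝ, Euc m × Euc N) 𝓘(ℝ, Euc m) π q.pt (dMomProj m N π q v) :=
  mfderiv_comp_apply q ((Fibered.contMDiff π _).mdifferentiableAt (by simp))
    ((contMDiff_Mom_proj π q).mdifferentiableAt (by simp)) v

theorem dJ1Base_eq (p : J1 (Euc m) (Euc N) π) (v) :
    dJ1Base m N π p v = mfderiv 𝓘(ℝ, Euc m × Euc N) 𝓘(ℝ, Euc m) π p.pt (dJ1Proj m N π p v) :=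
  mfderiv_comp_apply p ((Fibered.contMDiff π _).mdifferentiableAt (by simp))
    ((contMDiff_J1_proj π p).mdifferentiableAt (by simp)) v

/-- The Legendre map fixes the point of `E` by construction, so this is the chain rule for `κ ∘ F =
π¹`. -/
theorem dMomProj_comp_dLegendre (hF : ContMDiff 𝓘(ℝ, Euc m × JetFib m N) 𝓘(ℝ, Euc m × MomFib m N) ∞
    (legendre π vol L)) (p : J1 (Euc m) (Euc N) π) :
    (dMomProj m N π (legendre π vol L p)).comp (dLegendre π vol L p) = dJ1Proj m N π p :=
  (mfderiv_comp p ((contMDiff_Mom_proj (m := m) (N := N) π (legendre π vol L p)).mdifferentiableAt (by simp))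
    ((hF p).mdifferentiableAt (by simp))).symm

theorem dMomBase_comp_dLegendre (hF : ContMDiff 𝓘(ℝ, Euc m × JetFib m N) 𝓘(ℝ, Euc m × MomFib m N) ∞
    (legendre π vol L)) (p : J1 (Euc m) (Euc N) π) :
    (dMomBase m N π (legendre π vol L p)).comp (dLegendre π vol L p) = dJ1Base m N π p := by
  ext1 v
  refine (dMomBase_eq (legendre π vol L p) (dLegendre π vol L p v)).trans
    (Eq.trans ?_ (dJ1Base_eq p v).symm)
  exact congrArg (fun T => mfderiv 𝓘(ℝ, Euc m × Euc N) 𝓘(ℝ, Euc m) π p.pt (T v))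
    (dMomProj_comp_dLegendre hF p)

/-- `Θ_ℒ` is the pull-back of the Liouville form by the extended Legendre map. -/
theorem thetaL_eq_pullback (hF : ContMDiff 𝓘(ℝ, Euc m × JetFib m N) 𝓘(ℝ, Euc m × MomFib m N) ∞
    (legendre π vol L)) : thetaL π vol L = (liouvilleTheta m N π).pullback (legendre π vol L) := by
  funext p
  change (legendreForm π vol L p).compContinuousLinearMap (dJ1Proj m N π p) = _
  rw [← dMomProj_comp_dLegendre hF]
  rfl

/-- `Ω_ℒ` is the pull-back of `Ω` by the extended Legendre map. -/
theorem omegaL_eq_pullback (hF : ContMDiff 𝓘(ℝ, Euc m × JetFib m N) 𝓘(ℝ, Euc m × MomFib m N) ∞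
    (legendre π vol L)) (p : J1 (Euc m) (Euc N) π) : omegaL π vol L p =
      (liouvilleOmega m N π (legendre π vol L p)).compContinuousLinearMap (dLegendre π vol L p) := by
  change -(thetaL π vol L).d p = _
  rw [thetaL_eq_pullback hF, DForm.d_pullback hF (liouvilleTheta_smooth π)]
  rfl

end Operators

/-! ### Transfer of jet fields, connections and multivector classes between `J¹E` and `ℳπ`. -/

section Operators
variable {m N : ℕ} {M E : Type*} [TopologicalSpace M] [ChartedSpace (Euc m) M]
  [IsManifold 𝓘(ℝ, Euc m) ∞ M] [TopologicalSpace E]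
  [ChartedSpace (Euc m × Euc N) E]
  [IsManifold 𝓘(ℝ, Euc m × Euc N) ∞ E]
  {D S : Type*} [NormedAddCommGroup D] [NormedSpace ℝ D] [TopologicalSpace S] [ChartedSpace D S]
  {π : E → M} [Fibered (Euc m) (Euc N) π] {vol : DForm (Euc m) M m}
  {L : J1 (Euc m) (Euc N) π → ℝ} {j : S → J1 (Euc m) (Euc N) π}

theorem jetContr_omegaL (hF : ContMDiff 𝓘(ℝ, Euc m × JetFib m N) 𝓘(ℝ, Euc m × MomFib m N) ∞
    (legendre π vol L)) (p : J1 (Euc m) (Euc N) π) {H : Type*} [AddCommGroup H] [Module ℝ H]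
    [TopologicalSpace H]
    (σ : H →L[ℝ] TangentSpace 𝓘(ℝ, Euc m × JetFib m N) p) (Z w) :
    jetContr σ (omegaL π vol L p) Z w = jetContr ((dLegendre π vol L p).comp σ)
      (liouvilleOmega m N π (legendre π vol L p)) Z (dLegendre π vol L p w) := by
  rw [omegaL_eq_pullback hF, jetContr_comp]

theorem IsExtJetFieldOperator.isELJetField
    (hF : ContMDiff 𝓘(ℝ, Euc m × JetFib m N) 𝓘(ℝ, Euc m × MomFib m N) ∞ (legendre π vol L))
    {Y : JetOnMom π vol L j} (hY : IsExtJetFieldOperator D π vol L j Y) {Ψ : JetOnJ1 π j}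
    (hΨ : IsJetFieldOn D π j Ψ) (h : JetRelated π vol L j Ψ Y) : IsELJetField D π vol L j Ψ where
  structural := hΨ
  semiholonomic s := by
    have h1 := hY.semiholonomic s
    rw [← h s] at h1
    rw [← dMomProj_comp_dLegendre hF]
    exact h1
  field_eq s Z w := by
    have h1 := hY.field_eq s Z w
    rw [← h s] at h1
    exact (jetContr_omegaL hF (j s) (Ψ s).1 Z w).trans h1

theorem IsELJetField.existsUnique
    (hF : ContMDiff 𝓘(ℝ, Euc m × JetFib m N) 𝓘(ℝ, Euc m × MomFib m N) ∞ (legendre π vol L))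
    {Ψ : JetOnJ1 π j} (hΨ : IsELJetField D π vol L j Ψ) :
    ∃! Y : JetOnMom π vol L j, JetRelated π vol L j Ψ Y ∧ IsExtJetFieldOperator D π vol L j Y := by
  -- `J1.base` and the composite of `Mom.base` with the Legendre map agree by unfolding; the
  -- instance is transported so that the prolongation acts on the jet bundle in which `Ψ` takes
  -- values.
  let : Fibered (Euc m) (JetFib m N) (fun p => Mom.base (Euc m) (Euc N) m π (legendre π vol L p)) :=
    inferInstanceAs (Fibered (Euc m) (JetFib m N) (J1.base (Euc m) (Euc N) π))
  let Y : JetOnMom π vol L j := fun s =>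
    prolong (Mom.base (Euc m) (Euc N) m π) hF (j s) (Ψ s)
  refine ⟨Y, ⟨fun s => rfl, ?_, ?_, ?_⟩, fun Y' hY' => ?_⟩
  · exact (contMDiff_prolong (Mom.base (Euc m) (Euc N) m π) hF).comp hΨ.structural
  · intro s Z w
    exact (jetContr_omegaL hF (j s) (Ψ s).1 Z w).symm.trans (hΨ.field_eq s Z w)
  · intro s
    have h1 := hΨ.semiholonomic s
    rw [← dMomProj_comp_dLegendre hF] at h1
    exact h1
  · funext s
    exact Subtype.ext (hY'.1 s).symm

/-- Naturality of the contraction together with `Ω_ℒ = F*Ω`, for the whole expression in the field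
equation: one side vanishes exactly when the other does. -/
theorem connContr_omegaL (hF : ContMDiff 𝓘(ℝ, Euc m × JetFib m N) 𝓘(ℝ, Euc m × MomFib m N) ∞
    (legendre π vol L)) (p : J1 (Euc m) (Euc N) π)
    (C : TangentSpace 𝓘(ℝ, Euc m) (π p.pt) →L[ℝ] TangentSpace 𝓘(ℝ, Euc m × JetFib m N) p) :
    (connContr ((dLegendre π vol L p).comp C) (dMomBase m N π (legendre π vol L p))
      (liouvilleOmega m N π (legendre π vol L p)) -
        ((m : ℝ) - 1) • liouvilleOmega m N π (legendre π vol L p)).compContinuousLinearMap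
          (dLegendre π vol L p) =
      connContr C (dJ1Base m N π p) (omegaL π vol L p) - ((m : ℝ) - 1) • omegaL π vol L p := by
  have h1 := connContr_comp (dLegendre π vol L p) C (dMomBase m N π (legendre π vol L p))
    (liouvilleOmega m N π (legendre π vol L p))
  have h2 := h1.trans (congrArg₂ (fun t β => connContr C t β) (dMomBase_comp_dLegendre hF p)
    (omegaL_eq_pullback hF p).symm)
  rw [← h2]
  ext v
  have h3 := omegaL_eq_pullback hF p
  have h4 := congrArg (fun β => β v) h3
  exact congrArg (fun r : ℝ => connContr ((dLegendre π vol L p).comp C)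
    (dMomBase m N π (legendre π vol L p)) (liouvilleOmega m N π (legendre π vol L p))
      (fun i => dLegendre π vol L p (v i)) - ((m : ℝ) - 1) * r) h4.symm

theorem IsExtConnectionOperator.isELConnection
    (hF : ContMDiff 𝓘(ℝ, Euc m × JetFib m N) 𝓘(ℝ, Euc m × MomFib m N) ∞ (legendre π vol L))
    {C' : ConnOnMom π vol L j} (hC' : IsExtConnectionOperator D π vol L j C') {C : ConnOnJ1 π j}
    (hC : IsConnectionOn D π j C) (h : ConnRelated π vol L j C C') :
    IsELConnection D π vol L j C where
  structural := hC
  semiholonomic s := by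
    have h1 := hC'.semiholonomic s
    rw [← h s] at h1
    rw [← dMomProj_comp_dLegendre hF]
    exact h1
  field_eq s := by
    have h1 := hC'.field_eq s
    rw [← h s] at h1
    exact sub_eq_zero.1 ((connContr_omegaL hF (j s) (C s)).symm.trans h1)

/-- Semi-holonomy alone gives this: `Tπ̄¹ ∘ C = Tπ ∘ (Tπ¹ ∘ C) = Tπ ∘ σ`, and a jet `σ` is a section
of `Tπ`. -/
theorem IsELConnection.dJ1Base_apply {C : ConnOnJ1 π j} (hC : IsELConnection D π vol L j C) (s : S)
    (v : TangentSpace 𝓘(ℝ, Euc m) (π (j s).pt)) : dJ1Base m N π (j s) (C s v) = v := by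
  rw [dJ1Base_eq]
  exact (congrArg (fun T => mfderiv 𝓘(ℝ, Euc m × Euc N) 𝓘(ℝ, Euc m) π (j s).pt (T v))
    (hC.semiholonomic s)).trans ((j s).val.2 v)

theorem IsELConnection.existsUnique
    (hF : ContMDiff 𝓘(ℝ, Euc m × JetFib m N) 𝓘(ℝ, Euc m × MomFib m N) ∞ (legendre π vol L))
    {C : ConnOnJ1 π j} (hC : IsELConnection D π vol L j C) :
    ∃! C' : ConnOnMom π vol L j, ConnRelated π vol L j C C' ∧
      IsExtConnectionOperator D π vol L j C' := by
  let C' : ConnOnMom π vol L j := fun s => (dLegendre π vol L (j s)).comp (C s)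
  refine ⟨C', ⟨fun s => rfl, ⟨?_, ?_⟩, ?_, ?_⟩, fun C'' hC'' => ?_⟩
  · intro U Z hU hZ
    exact contMDiffOn_mfderiv_apply hF (hC.structural.smooth U Z hU hZ)
  · intro s ξ hξ v
    let T := dMomBase m N π (legendre π vol L (j s))
    have h1 : T (C' s (T v)) = T v :=
      (congrArg (fun R => R (C s (T v))) (dMomBase_comp_dLegendre hF (j s))).trans
        (hC.dJ1Base_apply s (T v))
    -- The pushed-forward connection still splits `T`, so `C' (T v) - v` is vertical and is
    -- annihilated by the semibasic covector `ξ`.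
    have h2 : ξ (C' s (T v) - v) = 0 := hξ _ (by
      change T (C' s (T v) - v) = 0
      rw [map_sub, h1, sub_self])
    rw [map_sub] at h2
    exact sub_eq_zero.1 h2
  · intro s
    exact (connContr_omegaL hF (j s) (C s)).trans (sub_eq_zero.2 (hC.field_eq s))
  · intro s
    have h1 := hC.semiholonomic s
    rw [← dMomProj_comp_dLegendre hF] at h1
    exact h1
  · funext s
    exact (hC''.1 s).symm

theorem pairing_map_dLegendre
    (hF : ContMDiff 𝓘(ℝ, Euc m × JetFib m N) 𝓘(ℝ, Euc m × MomFib m N) ∞ (legendre π vol L))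
    (p : J1 (Euc m) (Euc N) π) (x : ⋀[ℝ]^m (TangentSpace 𝓘(ℝ, Euc m × JetFib m N) p)) :
    pairing ((vol (π p.pt)).toAlternatingMap.compLinearMap
      (dMomBase m N π (legendre π vol L p)).toLinearMap)
        (exteriorPower.map m (dLegendre π vol L p).toLinearMap x) =
    pairing ((vol (π p.pt)).toAlternatingMap.compLinearMap (dJ1Base m N π p).toLinearMap) x :=
  pairing_compLinearMap_map (dMomBase_comp_dLegendre hF p) (vol (π p.pt)).toAlternatingMap x

theorem mvContr_omegaL (hF : ContMDiff 𝓘(ℝ, Euc m × JetFib m N) 𝓘(ℝ, Euc m × MomFib m N) ∞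
    (legendre π vol L)) (p : J1 (Euc m) (Euc N) π)
    (x : ⋀[ℝ]^m (TangentSpace 𝓘(ℝ, Euc m × JetFib m N) p)) (w) :
    mvContr x (omegaL π vol L p) w =
      mvContr (exteriorPower.map m (dLegendre π vol L p).toLinearMap x)
        (liouvilleOmega m N π (legendre π vol L p)) (dLegendre π vol L p w) :=
  mvContr_of_eq_pullback (omegaL_eq_pullback hF p) x w

theorem IsELMultiVF.smul (hm : 0 < m) {K : MVOnJ1 π j} (hK : IsELMultiVF D π vol L j K) {g : S → ℝ}
    (hg : ContMDiff 𝓘(ℝ, D) 𝓘(ℝ, ℝ) ∞ g) (hg0 : ∀ s, g s ≠ 0) :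
    IsELMultiVF D π vol L j (fun s => g s • K s) where
  structural := hK.structural.smul hm hg hg0
  transverse s := by
    rw [pairing_smul]
    exact mul_ne_zero (hg0 s) (hK.transverse s)
  semiholonomic s := by
    rw [map_smul, Submodule.span_singleton_smul_eq (IsUnit.mk0 _ (hg0 s)), hK.semiholonomic s]
  field_eq s w := by
    rw [mvContr_smul, hK.field_eq s w, mul_zero]

theorem IsExtMultiVFOperator.isELMultiVF
    (hF : ContMDiff 𝓘(ℝ, Euc m × JetFib m N) 𝓘(ℝ, Euc m × MomFib m N) ∞ (legendre π vol L))
    {K : MVOnMom π vol L j} (hK : IsExtMultiVFOperator D π vol L j K) {X : MVOnJ1 π j}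
    (hX : IsMultiVF (Euc m) (JetFib m N) D m j X) (h : MVRelated π vol L j X K) :
    IsELMultiVF D π vol L j X where
  structural := hX
  transverse s h0 := hK.transverse s ((congrArg (pairing _) (h s).symm).trans
    ((pairing_map_dLegendre hF (j s) (X s)).trans h0))
  semiholonomic s :=
    (span_map_of_comp_eq (dMomProj_comp_dLegendre hF (j s)) (h s)).symm.trans (hK.semiholonomic s)
  field_eq s w := (mvContr_omegaL hF (j s) (X s) w).trans
    ((congrArg (fun y => mvContr y (liouvilleOmega m N π (legendre π vol L (j s)))
      (dLegendre π vol L (j s) w)) (h s)).trans (hK.field_eq s w))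

/-- The delicate point is that the push-forward does not vanish, as `TF` need not be injective.
Transversality ensures it: pairing with the pulled-back volume form is unchanged by `ΛᵐTF` and is
non-zero on `X`. -/
theorem IsELMultiVF.isExtMultiVFOperator
    (hF : ContMDiff 𝓘(ℝ, Euc m × JetFib m N) 𝓘(ℝ, Euc m × MomFib m N) ∞ (legendre π vol L))
    {X : MVOnJ1 π j} (hX : IsELMultiVF D π vol L j X) :
    IsExtMultiVFOperator D π vol L j
      (fun s => exteriorPower.map m (dLegendre π vol L (j s)).toLinearMap (X s)) where
  structural := by
    have h1 : ∀ s, exteriorPower.map m (dLegendre π vol L (j s)).toLinearMap (X s) ≠ 0 :=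
      fun s h0 => hX.transverse s ((pairing_map_dLegendre hF (j s) (X s)).symm.trans
        ((congrArg (pairing _) h0).trans (pairing_zero _)))
    exact IsMultiVF.map (Φ := j) (K := X) (f := legendre π vol L) hX.structural hF h1
  transverse s := by
    intro h0
    exact hX.transverse s ((pairing_map_dLegendre hF (j s) (X s)).symm.trans h0)
  field_eq s w := (mvContr_omegaL hF (j s) (X s) w).symm.trans (hX.field_eq s w)
  semiholonomic s :=
    (span_map_of_comp_eq (dMomProj_comp_dLegendre hF (j s)) rfl).trans (hX.semiholonomic s)

theorem MVRelated.smul {X : MVOnJ1 π j} {K : MVOnMom π vol L j} (h : MVRelated π vol L j X K)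
    (g : S → ℝ) : MVRelated π vol L j (fun s => g s • X s) (fun s => g s • K s) :=
  fun s => map_smul_of_eq (h s) (g s)

theorem isMultiVF_of_mem (hm : 0 < m) {C : Set (MVOnJ1 π j)} (hC : IsMVFClassOn D π j C)
    {X : MVOnJ1 π j} (hX : X ∈ C) : IsMultiVF (Euc m) (JetFib m N) D m j X := by
  obtain ⟨X₀, hX₀, rfl⟩ := hC
  obtain ⟨g, hg, hg0, hgX⟩ := hX
  rw [show X = fun s => g s • X₀ s from funext hgX]
  exact hX₀.smul hm hg hg0

/-- One related pair suffices: its member `X` is Euler–Lagrange by naturality, and every other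
member of the class is a non-vanishing multiple of `X`, for which the conditions are homogeneous. -/
theorem IsExtClass.isELClass (hm : 0 < m)
    (hF : ContMDiff 𝓘(ℝ, Euc m × JetFib m N) 𝓘(ℝ, Euc m × MomFib m N) ∞ (legendre π vol L))
    {C' : Set (MVOnMom π vol L j)} (hC' : IsExtClass D π vol L j C') {C : Set (MVOnJ1 π j)}
    (hC : IsMVFClassOn D π j C) (h : ∀ K ∈ C', ∃ X ∈ C, MVRelated π vol L j X K) :
    IsELClass D π vol L j C := by
  refine ⟨hC, fun X' hX' => ?_⟩
  obtain ⟨⟨K, hK, rfl⟩, hC'K⟩ := hC'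
  obtain ⟨X, hX, hXK⟩ := h K self_mem_mvClass
  have hEL := (hC'K K self_mem_mvClass).isELMultiVF hF (isMultiVF_of_mem hm hC hX) hXK
  obtain ⟨X₀, hX₀, rfl⟩ := hC
  obtain ⟨g, hg, hg0, hgX⟩ := mem_mvClass_trans (mem_mvClass_symm hX) hX'
  rw [show X' = fun s => g s • X s from funext hgX]
  exact hEL.smul hm hg hg0

theorem IsELClass.existsUnique (hm : 0 < m)
    (hF : ContMDiff 𝓘(ℝ, Euc m × JetFib m N) 𝓘(ℝ, Euc m × MomFib m N) ∞ (legendre π vol L))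
    {C : Set (MVOnJ1 π j)} (hC : IsELClass D π vol L j C) :
    ∃! C' : Set (MVOnMom π vol L j), (∀ K ∈ C', ∃ X ∈ C, MVRelated π vol L j X K) ∧
      IsExtClass D π vol L j C' := by
  obtain ⟨⟨X, hX, rfl⟩, hEL⟩ := hC
  have hX_EL := hEL X self_mem_mvClass
  let K : MVOnMom π vol L j := fun s => exteriorPower.map m (dLegendre π vol L (j s)).toLinearMap (X s)
  have hXK : MVRelated π vol L j X K := fun s => rfl
  refine ⟨mvClass (Euc m) (MomFib m N) D m (fun s => legendre π vol L (j s)) K,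
    ⟨?_, ⟨K, (hX_EL.isExtMultiVFOperator hF).structural, rfl⟩, ?_⟩, ?_⟩
  · rintro K' ⟨g, hg, hg0, hgK⟩
    refine ⟨fun s => g s • X s, ⟨g, hg, hg0, fun s => rfl⟩, ?_⟩
    rw [show K' = fun s => g s • K s from funext hgK]
    exact hXK.smul g
  · rintro K' ⟨g, hg, hg0, hgK⟩
    have h1 := (hX_EL.smul hm hg hg0).isExtMultiVFOperator hF
    have h2 : K' = fun s => exteriorPower.map m (dLegendre π vol L (j s)).toLinearMap (g s • X s) :=
      funext fun s => (hgK s).trans (hXK.smul g s).symm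
    rw [h2]
    exact h1
  · rintro C' ⟨hC', ⟨K', hK', rfl⟩, -⟩
    -- Uniqueness: a representative `K'` of another admissible class is the image of some `g X`,
    -- hence equals `g K` and lies in the class of `K`.
    obtain ⟨X', ⟨g, hg, hg0, hgX⟩, hX'K'⟩ := hC' K' self_mem_mvClass
    refine mvClass_eq_of_mem ⟨g, hg, hg0, fun s => ?_⟩
    exact (hX'K' s).symm.trans ((congrArg (exteriorPower.map m
      (dLegendre π vol L (j s)).toLinearMap) (hgX s)).trans (hXK.smul g s))

end Operators

end FieldOp

end

/-! ### The equivalence theorem. -/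

theorem mainTheorem1 {m N : ℕ} (hm : 0 < m)
    {M : Type*} [TopologicalSpace M] [ChartedSpace (FieldOp.Euc m) M]
    [IsManifold 𝓘(ℝ, FieldOp.Euc m) ∞ M]
    {E : Type*} [TopologicalSpace E] [ChartedSpace (FieldOp.Euc m × FieldOp.Euc N) E]
    [IsManifold 𝓘(ℝ, FieldOp.Euc m × FieldOp.Euc N) ∞ E]
    (π : E → M) [FieldOp.Fibered (FieldOp.Euc m) (FieldOp.Euc N) π]
    (vol : FieldOp.DForm (FieldOp.Euc m) M m) (hvol : vol.Smooth) (hvol0 : ∀ x, vol x ≠ 0)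
    (L : FieldOp.J1 (FieldOp.Euc m) (FieldOp.Euc N) π → ℝ)
    (hL : ContMDiff 𝓘(ℝ, FieldOp.Euc m × FieldOp.JetFib m N) 𝓘(ℝ, ℝ) ∞ L)
    {V : Type*} [NormedAddCommGroup V] [NormedSpace ℝ V] [FiniteDimensional ℝ V]
    {S : Type*} [TopologicalSpace S] [ChartedSpace V S] [IsManifold 𝓘(ℝ, V) ∞ S]
    (j : S → FieldOp.J1 (FieldOp.Euc m) (FieldOp.Euc N) π)
    (hj : FieldOp.IsTransverseSubmanifold V π j) :
    -- jet fields
    ((∀ Y : FieldOp.JetOnMom π vol L j, FieldOp.IsExtJetFieldOperator V π vol L j Y →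
        ∀ Ψ : FieldOp.JetOnJ1 π j, FieldOp.IsJetFieldOn V π j Ψ →
          FieldOp.JetRelated π vol L j Ψ Y → FieldOp.IsELJetField V π vol L j Ψ) ∧
      (∀ Ψ : FieldOp.JetOnJ1 π j, FieldOp.IsELJetField V π vol L j Ψ →
        ∃! Y : FieldOp.JetOnMom π vol L j,
          FieldOp.JetRelated π vol L j Ψ Y ∧ FieldOp.IsExtJetFieldOperator V π vol L j Y)) ∧
    -- classes of m-vector fields
    ((∀ D : Set (FieldOp.MVOnMom π vol L j), FieldOp.IsExtClass V π vol L j D →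
        ∀ C : Set (FieldOp.MVOnJ1 π j), FieldOp.IsMVFClassOn V π j C →
          (∀ K ∈ D, ∃ X ∈ C, FieldOp.MVRelated π vol L j X K) →
            FieldOp.IsELClass V π vol L j C) ∧
      (∀ C : Set (FieldOp.MVOnJ1 π j), FieldOp.IsELClass V π vol L j C →
        ∃! D : Set (FieldOp.MVOnMom π vol L j),
          (∀ K ∈ D, ∃ X ∈ C, FieldOp.MVRelated π vol L j X K) ∧
            FieldOp.IsExtClass V π vol L j D)) ∧
    -- connections
    ((∀ C' : FieldOp.ConnOnMom π vol L j, FieldOp.IsExtConnectionOperator V π vol L j C' →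
        ∀ C : FieldOp.ConnOnJ1 π j, FieldOp.IsConnectionOn V π j C →
          FieldOp.ConnRelated π vol L j C C' → FieldOp.IsELConnection V π vol L j C) ∧
      (∀ C : FieldOp.ConnOnJ1 π j, FieldOp.IsELConnection V π vol L j C →
        ∃! C' : FieldOp.ConnOnMom π vol L j,
          FieldOp.ConnRelated π vol L j C C' ∧
            FieldOp.IsExtConnectionOperator V π vol L j C')) := by
  -- Smoothness of the volume form and of the Lagrangian enters all three parts through the
  -- smoothness of `F`.
  have hF := FieldOp.contMDiff_legendre π hvol hL
  exact ⟨⟨fun _ hY _ hΨ h => hY.isELJetField hF hΨ h, fun _ hΨ => hΨ.existsUnique hF⟩,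
    ⟨fun _ hD _ hC h => hD.isELClass hm hF hC h, fun _ hC => hC.existsUnique hm hF⟩,
    ⟨fun _ hC' _ hC h => hC'.isELConnection hF hC h, fun _ hC => hC.existsUnique hF⟩⟩
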